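/- Let $k$ be an algebraically closed field of characteristic zero, $A$ a commutative associative unital $k$-algebra (not necessarily finitely generated or reduced), $X=\operatorname{Spec}A$, and $\mathfrak g$ a finite-dimensional Lie algebra over $k$. Let $\Gamma$ be a finite group acting on $X$ by automorphisms over $k$ (equivalently, on $A$ by $k$-algebra automorphisms, via $\gamma\cdot f=f\circ\gamma^{-1}$) and on $\mathfrak g$ by Lie algebra automorphisms. Let $\mathfrak M=(\mathfrak g\otimes_k A)^\Gamma$, the Lie algebra of fixed points of the diagonal action on $\mathfrak g\otimes_k A$, whose bracket is $[u\otimes f,v\otimes g]=[u,v]\otimes fg$. Let $X_{\mathrm{rat}}$ be the set of $k$-rational points of $X$. For $x\in X_{\mathrm{rat}}$ let $\Gamma_x$ be the stabilizer of $x$, let $\mathfrak g^x=\mathfrak g^{\Gamma_x}$, let $\mathrm{ev}_x:\mathfrak M\to\mathfrak g^x$, $\alpha\mapsto\alpha(x)$, be evaluation at $x$, and let $\mathcal R_x$ be the set of isomorphism classes of irreducible finite-dimensional representations of $\mathfrak g^x$. For a finite subset $\mathbf x\subseteq X_{\mathrm{rat}}$ and finite-dimensional representations $\rho_x:\mathfrak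 g^x\to\operatorname{End}_k V_x$ ($x\in\mathbf x$), the associated evaluation representation of $\mathfrak M$ is the representation $\bigotimes_{x\in\mathbf x}(\rho_x\circ\mathrm{ev}_x)$ on $\bigotimes_{x\in\mathbf x}V_x$. Let $\mathcal E$ be the set of functions $\Psi$ that assign to each $x\in X_{\mathrm{rat}}$ a class $\Psi(x)\in\mathcal R_x$, that are $\Gamma$-equivariant, i.e. $\Psi(\gamma\cdot x)=[\rho\circ\gamma^{-1}]$ whenever $\Psi(x)=[\rho]$, and whose support $\operatorname{supp}\Psi$, the set of $x$ such that $\Psi(x)$ is not the class of the one-dimensional trivial representation, is finite. For $\Psi\in\mathcal E$ let $\mathrm{ev}_\Psi$ be the isomorphism class of the evaluation representation attached to a set $\mathbf x$ consisting of one point of each $\Gamma$-orbit in $\operatorname{supp}\Psi$ and to representations $\rho_x\in\Psi(x)$, $x\in\mathbf x$ (this is independent of the choices; if $\operatorname{supp}\Psi=\emptyset$, it is the class of the one-dimensional trivial representation). Let $\mathcal S$ be the set of isomorphism classes of irreducible finite-dimensional representations of $\mathfrak M$. An element $\lambda\in(\mathfrak M/[\mathfrak M,\mathfrak M])^*$ is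 identified with (the isomorphism class of) the one-dimensional representation $\alpha\mapsto\lambda(\alpha+[\mathfrak M,\mathfrak M])$ of $\mathfrak M$; every one-dimensional representation arises in this way from a unique $\lambda$. **Theorem.** 1. For $\lambda\in(\mathfrak M/[\mathfrak M,\mathfrak M])^*$ and $\Psi\in\mathcal E$ the class $\lambda\otimes\mathrm{ev}_\Psi$ lies in $\mathcal S$, and the map $$(\mathfrak M/[\mathfrak M,\mathfrak M])^*\times\mathcal E\to\mathcal S,\qquad(\lambda,\Psi)\mapsto\lambda\otimes\mathrm{ev}_\Psi,$$ is surjective. In particular, every irreducible finite-dimensional representation of $\mathfrak M$ is isomorphic to the tensor product of a one-dimensional representation and an evaluation representation. 2. If $\Psi,\Phi\in\mathcal E$ and $\dim\mathrm{ev}_\Phi=1$, then the function $\Psi\otimes\Phi$ given by $(\Psi\otimes\Phi)(x)=\Psi(x)\otimes\Phi(x)$ belongs to $\mathcal E$. For $\lambda,\lambda'\in(\mathfrak M/[\mathfrak M,\mathfrak M])^*$ and $\Psi,\Psi'\in\mathcal E$ one has $\lambda\otimes\mathrm{ev}_\Psi=\lambda'\otimes\mathrm{ev}_{\Psi'}$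 if and only if there is $\Phi\in\mathcal E$ with $\dim\mathrm{ev}_\Phi=1$, $\lambda'=\lambda-\mathrm{ev}_\Phi$ and $\mathrm{ev}_{\Psi'}=\mathrm{ev}_{\Psi\otimes\Phi}$. 3. The restriction of the map in (1) to either factor (times the zero element of the other) is injective: $\lambda\mapsto\lambda\otimes\mathrm{ev}_0$ is injective on $(\mathfrak M/[\mathfrak M,\mathfrak M])^*$, where $0\in\mathcal E$ is the function with empty support, and $\Psi\mapsto 0\otimes\mathrm{ev}_\Psi$ is injective on $\mathcal E$. -/

import Mathlib

open scoped TensorProduct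

universe u v w w' w₁ w₂ w₃

noncomputable section

/-! ### Finite-dimensional representations of a Lie algebra and their isomorphism classes -/

/-- A finite-dimensional representation of the Lie algebra `L` over `k`
(`L` itself may be infinite-dimensional). -/
structure LieFDRep (k : Type u) (L : Type v) [Field k] [LieRing L] [LieAlgebra k L] where
  carrier : Type w
  [addCommGroup : AddCommGroup carrier]
  [module : Module k carrier]
  [lieRingModule : LieRingModule L carrier]
  [lieModule : LieModule k L carrier]
  [finiteDimensional : FiniteDimensional k carrier]

namespace LieFDRep

attribute [instance] addCommGroup module lieRingModule lieModule finiteDimensional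

variable {k : Type u} [Field k]
variable {L : Type v} [LieRing L] [LieAlgebra k L]

/-- Two representations are isomorphic: there is an `L`-linear isomorphism of the underlying
spaces (which may live in different universes). -/
def Iso (ρ : LieFDRep.{u, v, w} k L) (σ : LieFDRep.{u, v, w'} k L) : Prop :=
  Nonempty (ρ.carrier ≃ₗ⁅k,L⁆ σ.carrier)

theorem Iso.of_linearEquiv {ρ : LieFDRep.{u, v, w} k L} {σ : LieFDRep.{u, v, w'} k L}
    (e : ρ.carrier ≃ₗ[k] σ.carrier) (h : ∀ (x : L) (m : ρ.carrier), e ⁅x, m⁆ = ⁅x, e m⁆) :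
    ρ.Iso σ :=
  ⟨{ e with map_lie' := by intro x m; exact h x m }⟩

theorem Iso.exists_linearEquiv {ρ : LieFDRep.{u, v, w} k L} {σ : LieFDRep.{u, v, w'} k L}
    (h : ρ.Iso σ) :
    ∃ e : ρ.carrier ≃ₗ[k] σ.carrier, ∀ (x : L) (m : ρ.carrier), e ⁅x, m⁆ = ⁅x, e m⁆ := by
  obtain ⟨e⟩ := h
  exact ⟨e.toLinearEquiv, fun x m => LieModuleHom.map_lie e.toLieModuleHom x m⟩

/-- Irreducibility: the representation is nonzero and has no proper nonzero subrepresentation. -/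
def IsIrreducible (ρ : LieFDRep.{u, v, w} k L) : Prop :=
  LieModule.IsIrreducible k L ρ.carrier

/-- The dimension of a representation. -/
def dim (ρ : LieFDRep.{u, v, w} k L) : ℕ := Module.finrank k ρ.carrier

/-- The representation given by a linear map `φ : L → End V` with `φ [x, y] = [φ x, φ y]`. -/
def ofLinear (V : Type w) [AddCommGroup V] [Module k V] [FiniteDimensional k V]
    (φ : L →ₗ[k] Module.End k V) (h : ∀ x y, φ ⁅x, y⁆ = φ x * φ y - φ y * φ x) :
    LieFDRep.{u, v, w} k L :=
  let i₁ : LieRingModule L V :=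
    { bracket := fun x m => φ x m
      add_lie := fun x y m => by simp
      lie_add := fun x m n => by simp
      leibniz_lie := fun x y m => by simp [h] }
  { carrier := V
    lieRingModule := i₁
    lieModule :=
      { smul_lie := fun t x m => by
          change φ (t • x) m = t • φ x m
          simp
        lie_smul := fun t x m => by
          change φ x (t • m) = t • φ x m
          simp } }

/-- Pull-back `ρ ∘ f` of a representation `ρ` of `L'` along a Lie algebra homomorphism
`f : L → L'`. -/
def comap {L' : Type w'} [LieRing L'] [LieAlgebra k L'] (f : L →ₗ⁅k⁆ L')
    (ρ : LieFDRep.{u, w', w} k L') : LieFDRep.{u, v, w} k L :=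
  let i₁ : LieRingModule L ρ.carrier := LieRingModule.compLieHom ρ.carrier f
  { carrier := ρ.carrier
    lieRingModule := i₁
    lieModule := LieModule.compLieHom ρ.carrier f }

/-- The tensor product `ρ ⊗ σ` of two representations of `L`:
`x (v ⊗ w) = (x v) ⊗ w + v ⊗ (x w)`. -/
def tensor (ρ : LieFDRep.{u, v, w} k L) (σ : LieFDRep.{u, v, w'} k L) :
    LieFDRep.{u, v, max w w'} k L where
  carrier := ρ.carrier ⊗[k] σ.carrier

section PiTensor

variable {n : ℕ} (ρ : Fin n → LieFDRep.{u, v, u} k L)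

/-- The linear map `x ↦ ∑ i, id ⊗ ⋯ ⊗ ρᵢ(x) ⊗ ⋯ ⊗ id`. -/
def piTensorAux : L →ₗ[k] Module.End k (⨂[k] i, (ρ i).carrier) :=
  ∑ i, ((PiTensorProduct.mapMultilinear k (fun i => (ρ i).carrier)
      (fun i => (ρ i).carrier)).toLinearMap (fun _ => LinearMap.id) i) ∘ₗ
    (LieModule.toEnd k L (ρ i).carrier : L →ₗ[k] Module.End k (ρ i).carrier)

theorem piTensorAux_apply (x : L) : piTensorAux ρ x = ∑ i, PiTensorProduct.mapMonoidHom
    (Pi.mulSingle i (LieModule.toEnd k L (ρ i).carrier x)) := by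
  simp only [piTensorAux, LinearMap.sum_apply]
  rfl

theorem piTensorAux_tprod (x : L) (m : ∀ i, (ρ i).carrier) :
    piTensorAux ρ x (PiTensorProduct.tprod k m) =
      ∑ i, PiTensorProduct.tprod k (Function.update m i ⁅x, m i⁆) := by
  rw [piTensorAux_apply, LinearMap.sum_apply]
  refine Finset.sum_congr rfl fun i _ => ?_
  rw [PiTensorProduct.mapMonoidHom_apply, PiTensorProduct.map_tprod]
  congr 1
  funext j
  by_cases h : j = i
  · subst h; simp
  · simp [h]

theorem piTensorAux_lie (x y : L) : piTensorAux ρ ⁅x, y⁆ =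
    piTensorAux ρ x * piTensorAux ρ y - piTensorAux ρ y * piTensorAux ρ x := by
  simp only [piTensorAux_apply, Finset.sum_mul_sum]
  conv_rhs => rw [Finset.sum_comm, ← Finset.sum_sub_distrib]
  refine Finset.sum_congr rfl fun i _ => ?_
  rw [← Finset.sum_sub_distrib, Finset.sum_eq_single i]
  · have hlin : ∀ a b : Module.End k (ρ i).carrier,
        PiTensorProduct.mapMonoidHom (R := k) (s := fun i => (ρ i).carrier)
            (Pi.mulSingle i (a - b)) =
          PiTensorProduct.mapMonoidHom (Pi.mulSingle i a) -
            PiTensorProduct.mapMonoidHom (Pi.mulSingle i b) := fun a b =>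
      map_sub ((PiTensorProduct.mapMultilinear k (fun i => (ρ i).carrier)
        (fun i => (ρ i).carrier)).toLinearMap (fun _ => LinearMap.id) i) a b
    rw [← map_mul, ← map_mul, ← Pi.mulSingle_mul, ← Pi.mulSingle_mul, ← hlin]
    congr 2
    ext m
    simp
  · intro j _ hj
    rw [← map_mul, ← map_mul, sub_eq_zero]
    congr 1
    exact Pi.mulSingle_commute hj _ _
  · simp

/-- The tensor product `ρ₁ ⊗ ⋯ ⊗ ρₙ` of `n` representations of `L`; an element `x` acts by
`∑ i, id ⊗ ⋯ ⊗ ρᵢ(x) ⊗ ⋯ ⊗ id`. For `n = 0` it is the trivial representation on `k`. -/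
def piTensor : LieFDRep.{u, v, u} k L :=
  ofLinear (⨂[k] i, (ρ i).carrier) (piTensorAux ρ) (piTensorAux_lie ρ)

end PiTensor

end LieFDRep

/-- The dual `(L / [L, L])^*` of the abelianization of `L`. -/
abbrev AbDual (k : Type u) (L : Type v) [Field k] [LieRing L] [LieAlgebra k L] : Type (max u v) :=
  Module.Dual k (L ⧸ ⁅(⊤ : LieIdeal k L), (⊤ : LieIdeal k L)⁆)

namespace LieFDRep

variable {k : Type u} [Field k] {L : Type v} [LieRing L] [LieAlgebra k L]

/-- The one-dimensional representation of `L` on `k` given by `lam ∈ (L / [L, L])^*`: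
`x` acts as multiplication by `lam` of the class of `x`. -/
def oneDim (lam : AbDual k L) : LieFDRep.{u, v, u} k L :=
  ofLinear k
    ((LinearMap.lsmul k k : k →ₗ[k] Module.End k k) ∘ₗ lam ∘ₗ
      ((LieSubmodule.Quotient.mk' ⁅(⊤ : LieIdeal k L), (⊤ : LieIdeal k L)⁆ :
        L →ₗ⁅k,L⁆ L ⧸ ⁅(⊤ : LieIdeal k L), (⊤ : LieIdeal k L)⁆) :
        L →ₗ[k] L ⧸ ⁅(⊤ : LieIdeal k L), (⊤ : LieIdeal k L)⁆))
    (by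
      intro x y
      have h : (LieSubmodule.Quotient.mk ⁅x, y⁆ :
          L ⧸ ⁅(⊤ : LieIdeal k L), (⊤ : LieIdeal k L)⁆) = 0 :=
        (LieSubmodule.Quotient.mk_eq_zero').2
          (LieSubmodule.lie_mem_lie (LieSubmodule.mem_top x) (LieSubmodule.mem_top y))
      refine LinearMap.ext fun c => ?_
      change lam (LieSubmodule.Quotient.mk ⁅x, y⁆) • c = _
      rw [h]
      simp [mul_left_comm])

end LieFDRep

namespace LieFDRep

variable {k : Type u} [Field k] {L : Type v} [LieRing L] [LieAlgebra k L]

theorem Iso.refl (ρ : LieFDRep.{u, v, w} k L) : ρ.Iso ρ := ⟨LieModuleEquiv.refl⟩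

theorem Iso.symm {ρ : LieFDRep.{u, v, w₁} k L} {σ : LieFDRep.{u, v, w₂} k L} (h : ρ.Iso σ) :
    σ.Iso ρ :=
  h.elim fun e => ⟨e.symm⟩

theorem Iso.trans {ρ : LieFDRep.{u, v, w₁} k L} {σ : LieFDRep.{u, v, w₂} k L}
    {τ : LieFDRep.{u, v, w₃} k L} (h : ρ.Iso σ) (h' : σ.Iso τ) : ρ.Iso τ :=
  h.elim fun e => h'.elim fun e' => ⟨e.trans e'⟩

theorem Iso.dim_eq {ρ : LieFDRep.{u, v, w₁} k L} {σ : LieFDRep.{u, v, w₂} k L} (h : ρ.Iso σ) :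
    ρ.dim = σ.dim :=
  h.elim fun e => LinearEquiv.finrank_eq e.toLinearEquiv

theorem Iso.isIrreducible {ρ : LieFDRep.{u, v, w₁} k L} {σ : LieFDRep.{u, v, w₂} k L}
    (h : ρ.Iso σ) (hρ : ρ.IsIrreducible) : σ.IsIrreducible := by
  obtain ⟨e⟩ := h
  have : LieModule.IsIrreducible k L ρ.carrier := hρ
  have : Nontrivial ρ.carrier := LieModule.nontrivial_of_isIrreducible k L ρ.carrier
  have : Nontrivial σ.carrier := e.symm.toEquiv.nontrivial
  refine LieModule.IsIrreducible.mk fun N hN => ?_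
  rcases eq_bot_or_eq_top (N.comap e.toLieModuleHom) with h | h
  · refine absurd ((LieSubmodule.eq_bot_iff N).2 fun m hm => ?_) hN
    have h1 : e.symm m ∈ N.comap e.toLieModuleHom := by
      rw [LieSubmodule.mem_comap]
      change e (e.symm m) ∈ N
      simpa using hm
    rw [h, LieSubmodule.mem_bot] at h1
    simpa using congrArg e h1
  · refine eq_top_iff.2 fun m _ => ?_
    have h1 : e.symm m ∈ N.comap e.toLieModuleHom := by rw [h]; exact LieSubmodule.mem_top _
    rw [LieSubmodule.mem_comap] at h1
    change e (e.symm m) ∈ N at h1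
    simpa using h1

theorem Iso.comap {L' : Type w'} [LieRing L'] [LieAlgebra k L'] (f : L →ₗ⁅k⁆ L')
    {ρ : LieFDRep.{u, w', w₁} k L'} {σ : LieFDRep.{u, w', w₂} k L'} (h : ρ.Iso σ) :
    (ρ.comap f).Iso (σ.comap f) := by
  obtain ⟨e, he⟩ := h.exists_linearEquiv
  exact Iso.of_linearEquiv (ρ := ρ.comap f) (σ := σ.comap f) e fun x m => he (f x) m

theorem Iso.tensor {ρ ρ' σ σ' : LieFDRep.{u, v, w} k L} (h : ρ.Iso ρ') (h' : σ.Iso σ') :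
    (ρ.tensor σ).Iso (ρ'.tensor σ') := by
  obtain ⟨e, he⟩ := h.exists_linearEquiv
  obtain ⟨f, hf⟩ := h'.exists_linearEquiv
  refine Iso.of_linearEquiv (ρ := ρ.tensor σ) (σ := ρ'.tensor σ')
    (TensorProduct.congr e f) fun x m => ?_
  change ρ.carrier ⊗[k] σ.carrier at m
  change TensorProduct.congr e f ⁅x, m⁆ = ⁅x, TensorProduct.congr e f m⁆
  induction m with
  | zero => simp
  | tmul a b => simp [TensorProduct.LieModule.lie_tmul_right, he, hf]
  | add a b ha hb => simp [ha, hb]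

theorem ofLinear_iso {V : Type w₁} {W : Type w₂} [AddCommGroup V] [Module k V]
    [FiniteDimensional k V] [AddCommGroup W] [Module k W] [FiniteDimensional k W]
    {φ : L →ₗ[k] Module.End k V} {ψ : L →ₗ[k] Module.End k W}
    (hφ : ∀ x y, φ ⁅x, y⁆ = φ x * φ y - φ y * φ x) (hψ : ∀ x y, ψ ⁅x, y⁆ = ψ x * ψ y - ψ y * ψ x)
    (e : V ≃ₗ[k] W) (h : ∀ x, e.toLinearMap ∘ₗ φ x = ψ x ∘ₗ e.toLinearMap) :
    (ofLinear V φ hφ).Iso (ofLinear W ψ hψ) :=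
  Iso.of_linearEquiv (ρ := ofLinear V φ hφ) (σ := ofLinear W ψ hψ) e
    fun x m => LinearMap.congr_fun (h x) m

theorem Iso.piTensor {n m : ℕ} {ρ : Fin n → LieFDRep.{u, v, u} k L}
    {σ : Fin m → LieFDRep.{u, v, u} k L} (e : Fin n ≃ Fin m) (h : ∀ i, (ρ (e.symm i)).Iso (σ i)) :
    (piTensor ρ).Iso (piTensor σ) := by
  choose f hf using fun i => (h i).exists_linearEquiv
  refine ofLinear_iso _ _
    (PiTensorProduct.reindex k (fun i => (ρ i).carrier) e ≪≫ₗ PiTensorProduct.congr f)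
    fun x => ?_
  ext v
  simp only [LinearMap.compMultilinearMap_apply, LinearMap.comp_apply, LinearEquiv.coe_coe,
    LinearEquiv.trans_apply, piTensorAux_tprod, map_sum, PiTensorProduct.reindex_tprod,
    PiTensorProduct.congr_tprod]
  refine Fintype.sum_equiv e _ _ fun i => ?_
  congr 1
  funext j
  by_cases hj : j = e i
  · subst hj
    simp only [Function.update_self, ← hf]
    congr 1
    have key : ∀ i', i' = i → Function.update v i ⁅x, v i⁆ i' = ⁅x, v i'⁆ := by
      rintro _ rfl; simp
    exact key _ (by simp)
  · have : e.symm j ≠ i := fun h => hj (by simp [← h])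
    simp [Function.update_of_ne hj, Function.update_of_ne this]

/-- Isomorphism of representations as an equivalence relation. -/
instance isoSetoid : Setoid (LieFDRep.{u, v, w} k L) where
  r := Iso
  iseqv := ⟨Iso.refl, Iso.symm, Iso.trans⟩

end LieFDRep

/-- The isomorphism classes of finite-dimensional representations of `L`. (Every such
representation is isomorphic to one whose space lies in the universe of `k`.) -/
def LieRepClass (k : Type u) (L : Type v) [Field k] [LieRing L] [LieAlgebra k L] :
    Type (max (u + 1) v) :=
  Quotient (LieFDRep.isoSetoid : Setoid (LieFDRep.{u, v, u} k L))

namespace LieRepClass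

variable {k : Type u} [Field k] {L : Type v} [LieRing L] [LieAlgebra k L]

/-- The isomorphism class `[ρ]`. -/
def mk (ρ : LieFDRep.{u, v, u} k L) : LieRepClass k L := Quotient.mk _ ρ

theorem mk_eq_mk {ρ σ : LieFDRep.{u, v, u} k L} : mk ρ = mk σ ↔ ρ.Iso σ := Quotient.eq

/-- A class is irreducible if its members are. -/
def IsIrreducible (c : LieRepClass k L) : Prop :=
  Quotient.liftOn c LieFDRep.IsIrreducible fun _ _ h =>
    propext ⟨LieFDRep.Iso.isIrreducible h, LieFDRep.Iso.isIrreducible (LieFDRep.Iso.symm h)⟩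

/-- The common dimension of the members of a class. -/
def dim (c : LieRepClass k L) : ℕ :=
  Quotient.liftOn c LieFDRep.dim fun _ _ h => LieFDRep.Iso.dim_eq h

/-- `[ρ] ⊗ [σ] = [ρ ⊗ σ]`. -/
def tensor (c d : LieRepClass k L) : LieRepClass k L :=
  Quotient.map₂ LieFDRep.tensor (fun _ _ h _ _ h' => LieFDRep.Iso.tensor h h') c d

/-- Pull-back along a Lie algebra homomorphism, `[ρ] ↦ [ρ ∘ f]`. -/
def comap {L' : Type w'} [LieRing L'] [LieAlgebra k L'] (f : L →ₗ⁅k⁆ L')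
    (c : LieRepClass k L') : LieRepClass k L :=
  Quotient.map (LieFDRep.comap f) (fun _ _ h => LieFDRep.Iso.comap f h) c

/-- The class of the one-dimensional representation given by `lam ∈ (L / [L, L])^*`. -/
def ofDual (lam : AbDual k L) : LieRepClass k L := mk (LieFDRep.oneDim lam)

/-- The class of the one-dimensional trivial representation. -/
def trivial : LieRepClass k L := ofDual 0

theorem lie_oneDim_zero (x : L) (m : (LieFDRep.oneDim (0 : AbDual k L)).carrier) : ⁅x, m⁆ = 0 :=
  zero_mul (M₀ := k) m

theorem comap_trivial {L' : Type w'} [LieRing L'] [LieAlgebra k L'] (f : L →ₗ⁅k⁆ L') :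
    comap f (trivial : LieRepClass k L') = trivial := by
  refine mk_eq_mk.2 (LieFDRep.Iso.of_linearEquiv
    (ρ := (LieFDRep.oneDim (0 : AbDual k L')).comap f) (σ := LieFDRep.oneDim (0 : AbDual k L))
    (LinearEquiv.refl k k) fun x m => ?_)
  rw [lie_oneDim_zero]
  exact lie_oneDim_zero (k := k) (f x) m

theorem trivial_tensor_trivial :
    tensor (trivial : LieRepClass k L) trivial = trivial := by
  refine mk_eq_mk.2 (LieFDRep.Iso.of_linearEquiv
    (ρ := (LieFDRep.oneDim (0 : AbDual k L)).tensor (LieFDRep.oneDim 0))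
    (σ := LieFDRep.oneDim (0 : AbDual k L))
    (TensorProduct.lid k k : k ⊗[k] k ≃ₗ[k] k) fun x m => ?_)
  rw [lie_oneDim_zero]
  have : ∀ t : (LieFDRep.oneDim (0 : AbDual k L)).carrier ⊗[k]
      (LieFDRep.oneDim (0 : AbDual k L)).carrier, ⁅x, t⁆ = 0 := by
    intro t
    induction t with
    | zero => simp
    | tmul a b => simp [TensorProduct.LieModule.lie_tmul_right, lie_oneDim_zero]
    | add a b ha hb => simp [ha, hb]
  rw [show ⁅x, m⁆ = 0 from this m]
  exact map_zero (TensorProduct.lid k k)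

theorem comap_tensor {L' : Type w'} [LieRing L'] [LieAlgebra k L'] (f : L →ₗ⁅k⁆ L')
    (c d : LieRepClass k L') : comap f (tensor c d) = tensor (comap f c) (comap f d) := by
  induction c using Quotient.inductionOn with | _ ρ
  induction d using Quotient.inductionOn with | _ σ
  refine mk_eq_mk.2 (LieFDRep.Iso.of_linearEquiv
    (ρ := (ρ.tensor σ).comap f) (σ := (ρ.comap f).tensor (σ.comap f))
    (LinearEquiv.refl k (ρ.carrier ⊗[k] σ.carrier)) fun x m => ?_)
  rfl

end LieRepClass

/-! ### Equivariant map algebras -/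

/-- An action of the group `Γ` on the affine scheme `X = Spec A` over `k` (given by the induced
action `γ • f = f ∘ γ⁻¹` on `A` by `k`-algebra automorphisms) and on the Lie algebra `𝔤` by Lie
algebra automorphisms. -/
structure EquivariantPair (k : Type u) (A : Type v) (𝔤 : Type w) (Γ : Type w')
    [Field k] [CommRing A] [Algebra k A] [LieRing 𝔤] [LieAlgebra k 𝔤] [Group Γ] where
  onAlg : Γ →* (A ≃ₐ[k] A)
  onLie : Γ →* (𝔤 ≃ₗ[k] 𝔤)
  onLie_lie : ∀ (γ : Γ) (x y : 𝔤), onLie γ ⁅x, y⁆ = ⁅onLie γ x, onLie γ y⁆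

/-- The `k`-rational points of `X = Spec A`, i.e. the `k`-algebra homomorphisms `A → k`;
the homomorphism `x` is `f ↦ f(x)`. -/
abbrev RatPoint (k : Type u) (A : Type v) [Field k] [CommRing A] [Algebra k A] := A →ₐ[k] k

namespace EquivariantPair

open LieAlgebra

variable {k : Type u} {A : Type v} {𝔤 : Type w} {Γ : Type w'}
  [Field k] [CommRing A] [Algebra k A] [LieRing 𝔤] [LieAlgebra k 𝔤] [Group Γ]
  (D : EquivariantPair k A 𝔤 Γ)

/-- The action of `γ` on `𝔤`, as a Lie algebra homomorphism. -/
def lieHom (γ : Γ) : 𝔤 →ₗ⁅k⁆ 𝔤 :=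
  { (D.onLie γ : 𝔤 →ₗ[k] 𝔤) with map_lie' := D.onLie_lie γ _ _ }

/-- The action of `γ` on `A ⊗ 𝔤`, `γ (f ⊗ u) = (γ f) ⊗ (γ u)`. -/
def onTensor (γ : Γ) : A ⊗[k] 𝔤 →ₗ⁅k⁆ A ⊗[k] 𝔤 :=
  ExtendScalars.map (D.onAlg γ : A →ₐ[k] A) (D.lieHom γ)

/-- The equivariant map algebra `M(X, 𝔤)^Γ = (A ⊗ 𝔤)^Γ`, with the bracket
`[f ⊗ u, g ⊗ v] = fg ⊗ [u, v]`. -/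
def mapAlgebra : LieSubalgebra k (A ⊗[k] 𝔤) where
  carrier := {α | ∀ γ : Γ, D.onTensor γ α = α}
  add_mem' := fun ha hb γ => by rw [map_add, ha γ, hb γ]
  zero_mem' := fun γ => map_zero _
  smul_mem' := fun c α ha γ => by rw [map_smul, ha γ]
  lie_mem' := fun ha hb γ => by rw [LieHom.map_lie, ha γ, hb γ]

/-- The action of `γ` on rational points: `f(γ x) = (γ⁻¹ f)(x)`. -/
def actPoint (γ : Γ) (x : RatPoint k A) : RatPoint k A :=
  x.comp (D.onAlg γ⁻¹ : A →ₐ[k] A)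

/-- The subalgebra `𝔤^x` of elements of `𝔤` fixed by the stabilizer of `x`. -/
def isotropy (x : RatPoint k A) : LieSubalgebra k 𝔤 where
  carrier := {u | ∀ γ : Γ, D.actPoint γ x = x → D.onLie γ u = u}
  add_mem' := fun ha hb γ h => by rw [map_add, ha γ h, hb γ h]
  zero_mem' := fun γ _ => map_zero _
  smul_mem' := fun c α ha γ h => by rw [map_smul, ha γ h]
  lie_mem' := fun ha hb γ h => by rw [D.onLie_lie, ha γ h, hb γ h]

/-- Evaluation `A ⊗ 𝔤 → 𝔤` at a rational point, `f ⊗ u ↦ f(x) u`. -/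
def evalTensor (x : RatPoint k A) : A ⊗[k] 𝔤 →ₗ⁅k⁆ 𝔤 :=
  { (TensorProduct.lid k 𝔤 : k ⊗[k] 𝔤 →ₗ[k] 𝔤) ∘ₗ
      (TensorProduct.map x.toLinearMap LinearMap.id : A ⊗[k] 𝔤 →ₗ[k] k ⊗[k] 𝔤) with
    map_lie' := by
      intro α β
      simp only [AddHom.toFun_eq_coe, LinearMap.coe_toAddHom]
      induction α with
      | zero => simp
      | add a b ha hb => simp only [add_lie, map_add, ha, hb]
      | tmul f u =>
        induction β with
        | zero => simp
        | add a b ha hb => simp only [lie_add, map_add, ha, hb]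
        | tmul g v => simp [mul_smul, smul_comm (x f) (x g)] }

theorem evalTensor_tmul (x : RatPoint k A) (f : A) (u : 𝔤) :
    evalTensor x (f ⊗ₜ[k] u) = x f • u := by
  change (TensorProduct.lid k 𝔤) (TensorProduct.map x.toLinearMap LinearMap.id (f ⊗ₜ[k] u)) = _
  simp

theorem evalTensor_actPoint (γ : Γ) (x : RatPoint k A) (α : A ⊗[k] 𝔤) :
    evalTensor (D.actPoint γ x) (D.onTensor γ α) = D.onLie γ (evalTensor x α) := by
  induction α with
  | zero => simp
  | add a b ha hb => simp only [map_add, ha, hb]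
  | tmul f u =>
    have h : D.onTensor γ (f ⊗ₜ[k] u) = D.onAlg γ f ⊗ₜ[k] D.onLie γ u := rfl
    have h' : (D.actPoint γ x) (D.onAlg γ f) = x f := by
      change x (D.onAlg γ⁻¹ (D.onAlg γ f)) = x f
      rw [← AlgEquiv.mul_apply, ← map_mul]
      simp
    rw [h, evalTensor_tmul, evalTensor_tmul, h', map_smul]

theorem evalTensor_mem (x : RatPoint k A) {α : A ⊗[k] 𝔤} (hα : α ∈ D.mapAlgebra) :
    evalTensor x α ∈ D.isotropy x := by
  intro γ h
  have h1 := D.evalTensor_actPoint γ x α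
  rw [hα γ, h] at h1
  exact h1.symm

/-- The evaluation homomorphism `ev_x : M(X, 𝔤)^Γ → 𝔤^x`, `α ↦ α(x)`. -/
def ev (x : RatPoint k A) : D.mapAlgebra →ₗ⁅k⁆ D.isotropy x where
  toFun α := ⟨evalTensor x α.1, D.evalTensor_mem x α.2⟩
  map_add' α β := Subtype.ext (map_add (evalTensor x) α.1 β.1)
  map_smul' c α := Subtype.ext (map_smul (evalTensor x) c α.1)
  map_lie' {α β} := Subtype.ext (LieHom.map_lie (evalTensor x) α.1 β.1)

theorem actPoint_mul (γ δ : Γ) (x : RatPoint k A) :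
    D.actPoint (γ * δ) x = D.actPoint γ (D.actPoint δ x) := by
  ext f
  simp [actPoint]

theorem actPoint_one (x : RatPoint k A) : D.actPoint 1 x = x := by
  ext f
  simp [actPoint]

theorem onLie_inv_mem (γ : Γ) (x : RatPoint k A) {u : 𝔤} (hu : u ∈ D.isotropy (D.actPoint γ x)) :
    D.onLie γ⁻¹ u ∈ D.isotropy x := by
  intro δ h
  have h1 := hu (γ * δ * γ⁻¹) (by
    rw [← D.actPoint_mul, inv_mul_cancel_right, D.actPoint_mul, h])
  rw [← LinearEquiv.mul_apply, ← map_mul,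
    show δ * γ⁻¹ = γ⁻¹ * (γ * δ * γ⁻¹) by group, map_mul, LinearEquiv.mul_apply, h1]

/-- The isomorphism `𝔤^{γ x} → 𝔤^x`, `u ↦ γ⁻¹ u`. -/
def transport (γ : Γ) (x : RatPoint k A) : D.isotropy (D.actPoint γ x) →ₗ⁅k⁆ D.isotropy x where
  toFun u := ⟨D.onLie γ⁻¹ u.1, D.onLie_inv_mem γ x u.2⟩
  map_add' u v := Subtype.ext (map_add (D.onLie γ⁻¹) u.1 v.1)
  map_smul' c u := Subtype.ext (map_smul (D.onLie γ⁻¹) c u.1)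
  map_lie' {u v} := Subtype.ext (D.onLie_lie γ⁻¹ u.1 v.1)

theorem transport_ev (γ : Γ) (x : RatPoint k A) (α : D.mapAlgebra) :
    D.transport γ x (D.ev (D.actPoint γ x) α) = D.ev x α := by
  refine Subtype.ext ?_
  change D.onLie γ⁻¹ (evalTensor (D.actPoint γ x) α.1) = evalTensor x α.1
  conv_lhs => rw [← α.2 γ]
  rw [D.evalTensor_actPoint, ← LinearEquiv.mul_apply, ← map_mul]
  simp

/-- The evaluation representation attached to rational points `x₁, …, xₙ` and representations
`ρᵢ` of `𝔤^{xᵢ}`: it is `α ↦ ∑ i, id ⊗ ⋯ ⊗ ρᵢ(α(xᵢ)) ⊗ ⋯ ⊗ id` on the tensor product of the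
representation spaces. -/
def evRep {n : ℕ} (x : Fin n → RatPoint k A)
    (ρ : ∀ i, LieFDRep.{u, w, u} k (D.isotropy (x i))) :
    LieFDRep.{u, max v w, u} k D.mapAlgebra :=
  LieFDRep.piTensor fun i => (ρ i).comap (D.ev (x i))

/-- A representation of `M(X, 𝔤)^Γ` is an evaluation representation if it is isomorphic to the
one attached to some finite set of rational points `x` and representations of the `𝔤^x`. -/
def IsEvaluation (ρ : LieFDRep.{u, max v w, u} k D.mapAlgebra) : Prop :=
  ∃ (n : ℕ) (x : Fin n → RatPoint k A) (σ : ∀ i, LieFDRep.{u, w, u} k (D.isotropy (x i))),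
    Function.Injective x ∧ ρ.Iso (D.evRep x σ)

/-- Functions `Ψ` assigning to each rational point `x` an isomorphism class `Ψ(x)` of
finite-dimensional representations of `𝔤^x`, which are `Γ`-equivariant, `Ψ(γ x) = γ Ψ(x)` with
`γ [ρ] = [ρ ∘ γ⁻¹]`, and whose support `{x | Ψ(x) is not the class of the trivial
one-dimensional representation}` is finite. Irreducibility is imposed in `irredFun`. -/
@[ext]
structure ClassFun where
  toFun : ∀ x : RatPoint k A, LieRepClass k (D.isotropy x)
  equivariant : ∀ (γ : Γ) (x : RatPoint k A),
    toFun (D.actPoint γ x) = LieRepClass.comap (D.transport γ x) (toFun x)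
  finite_support : {x | toFun x ≠ LieRepClass.trivial}.Finite

/-- The set `𝓔` of finitely supported `Γ`-equivariant functions `Ψ` such that each `Ψ(x)` is an
isomorphism class of irreducible finite-dimensional representations of `𝔤^x`. -/
def irredFun : Set D.ClassFun := {Ψ | ∀ x, (Ψ.toFun x).IsIrreducible}

/-- The isomorphism classes of irreducible finite-dimensional representations of `M(X, 𝔤)^Γ`. -/
def irredClasses : Set (LieRepClass k D.mapAlgebra) := {c | c.IsIrreducible}

namespace ClassFun

variable {D}

/-- The pointwise tensor product, `(Ψ ⊗ Φ)(x) = Ψ(x) ⊗ Φ(x)`. -/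
def tensor (Ψ Φ : D.ClassFun) : D.ClassFun where
  toFun x := (Ψ.toFun x).tensor (Φ.toFun x)
  equivariant γ x := by
    rw [Ψ.equivariant, Φ.equivariant, LieRepClass.comap_tensor]
  finite_support := by
    refine (Ψ.finite_support.union Φ.finite_support).subset fun x hx => ?_
    by_contra h
    simp only [Set.mem_union, Set.mem_ofPred_eq, not_or, not_not] at h
    apply hx
    rw [h.1, h.2, LieRepClass.trivial_tensor_trivial]

/-- The function `0` with empty support: every value is the trivial class. -/
def zero (D : EquivariantPair k A 𝔤 Γ) : D.ClassFun where
  toFun _ := LieRepClass.trivial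
  equivariant _ _ := (LieRepClass.comap_trivial _).symm
  finite_support := by simp

/-- The points `x₁, …, xₙ` are a system of representatives of the `Γ`-orbits in the support
of `Ψ`: each lies in the support, and each point of the support is in the orbit of exactly
one of them. -/
def IsTransversal (Ψ : D.ClassFun) {n : ℕ} (x : Fin n → RatPoint k A) : Prop :=
  (∀ i, Ψ.toFun (x i) ≠ LieRepClass.trivial) ∧
    ∀ y, Ψ.toFun y ≠ LieRepClass.trivial → ∃! i, ∃ γ : Γ, D.actPoint γ (x i) = y

theorem exists_isTransversal (Ψ : D.ClassFun) :
    ∃ (n : ℕ) (x : Fin n → RatPoint k A), Ψ.IsTransversal x := by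
  classical
  let S : Setoid (RatPoint k A) :=
    { r := fun x y => ∃ γ : Γ, D.actPoint γ x = y
      iseqv :=
        { refl := fun x => ⟨1, D.actPoint_one x⟩
          symm := by
            rintro x _ ⟨γ, rfl⟩
            exact ⟨γ⁻¹, by rw [← D.actPoint_mul, inv_mul_cancel, D.actPoint_one]⟩
          trans := by
            rintro x _ _ ⟨γ, rfl⟩ ⟨δ, rfl⟩
            exact ⟨δ * γ, D.actPoint_mul δ γ x⟩ } }
  let T : Set (Quotient S) := Quotient.mk S '' {x | Ψ.toFun x ≠ LieRepClass.trivial}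
  have hT : T.Finite := Ψ.finite_support.image _
  have : Finite T := hT
  obtain ⟨n, ⟨e⟩⟩ := Finite.exists_equiv_fin T
  choose x hx hx' using fun t : T => t.2
  refine ⟨n, fun i => x (e.symm i), fun i => hx _, fun y hy => ?_⟩
  refine ⟨e ⟨Quotient.mk S y, y, hy, rfl⟩, ?_, ?_⟩
  · have h := hx' ⟨Quotient.mk S y, y, hy, rfl⟩
    have h2 : ∃ γ : Γ, D.actPoint γ (x ⟨Quotient.mk S y, y, hy, rfl⟩) = y := Quotient.exact h
    simpa using h2
  · rintro i ⟨γ, hγ⟩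
    rw [← Equiv.symm_apply_eq]
    refine Subtype.ext ?_
    rw [← hx' (e.symm i)]
    exact Quotient.sound (s := S) ⟨γ, hγ⟩

/-- The isomorphism class `ev_Ψ` of the evaluation representation attached to representatives
`x₁, …, xₙ` of the orbits in the support of `Ψ` and to representations in the classes `Ψ(xᵢ)`.
By `evClass_eq` below it does not depend on these choices. -/
def evClass (Ψ : D.ClassFun) : LieRepClass k D.mapAlgebra :=
  LieRepClass.mk (D.evRep Ψ.exists_isTransversal.choose_spec.choose
    fun i => Quotient.out (Ψ.toFun (Ψ.exists_isTransversal.choose_spec.choose i)))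

theorem comap_ev_iso (Ψ : D.ClassFun) {x y : RatPoint k A} (h : ∃ γ : Γ, D.actPoint γ x = y)
    (ρ : LieFDRep.{u, w, u} k (D.isotropy x)) (σ : LieFDRep.{u, w, u} k (D.isotropy y))
    (hρ : LieRepClass.mk ρ = Ψ.toFun x) (hσ : LieRepClass.mk σ = Ψ.toFun y) :
    (ρ.comap (D.ev x)).Iso (σ.comap (D.ev y)) := by
  obtain ⟨γ, rfl⟩ := h
  rw [Ψ.equivariant, ← hρ] at hσ
  have h1 : (ρ.comap (D.transport γ x)).Iso σ := LieRepClass.mk_eq_mk.1 hσ.symm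
  refine LieFDRep.Iso.trans ?_ (h1.comap (D.ev (D.actPoint γ x)))
  refine LieFDRep.Iso.of_linearEquiv (ρ := ρ.comap (D.ev x))
    (σ := (ρ.comap (D.transport γ x)).comap (D.ev (D.actPoint γ x)))
    (LinearEquiv.refl k ρ.carrier) fun α m => ?_
  have h2 : ∀ m : ρ.carrier,
      ⁅D.ev x α, m⁆ = ⁅D.transport γ x (D.ev (D.actPoint γ x) α), m⁆ := fun m => by
    rw [D.transport_ev]
  exact h2 m

theorem evRep_iso (Ψ : D.ClassFun) {n m : ℕ} {x : Fin n → RatPoint k A} {y : Fin m → RatPoint k A}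
    (hx : Ψ.IsTransversal x) (hy : Ψ.IsTransversal y)
    (ρ : ∀ i, LieFDRep.{u, w, u} k (D.isotropy (x i)))
    (σ : ∀ i, LieFDRep.{u, w, u} k (D.isotropy (y i)))
    (hρ : ∀ i, LieRepClass.mk (ρ i) = Ψ.toFun (x i))
    (hσ : ∀ i, LieRepClass.mk (σ i) = Ψ.toFun (y i)) :
    (D.evRep x ρ).Iso (D.evRep y σ) := by
  have symm : ∀ {a b : RatPoint k A}, (∃ γ : Γ, D.actPoint γ a = b) →
      ∃ γ : Γ, D.actPoint γ b = a := by
    rintro a _ ⟨γ, rfl⟩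
    exact ⟨γ⁻¹, by rw [← D.actPoint_mul, inv_mul_cancel, D.actPoint_one]⟩
  choose f hf hf' using fun j => hx.2 (y j) (hy.1 j)
  choose g hg hg' using fun i => hy.2 (x i) (hx.1 i)
  dsimp only at hf hf' hg hg'
  let e : Fin n ≃ Fin m :=
    { toFun := g
      invFun := f
      left_inv := fun i => by
        obtain ⟨j, _, hj⟩ := hx.2 (x i) (hx.1 i)
        obtain ⟨γ, hγ⟩ := hf (g i)
        obtain ⟨δ, hδ⟩ := hg i
        rw [hj (f (g i)) ⟨δ * γ, by rw [D.actPoint_mul, hγ, hδ]⟩, hj i ⟨1, D.actPoint_one _⟩]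
      right_inv := fun i => by
        obtain ⟨j, _, hj⟩ := hy.2 (y i) (hy.1 i)
        obtain ⟨γ, hγ⟩ := hg (f i)
        obtain ⟨δ, hδ⟩ := hf i
        rw [hj (g (f i)) ⟨δ * γ, by rw [D.actPoint_mul, hγ, hδ]⟩, hj i ⟨1, D.actPoint_one _⟩] }
  exact LieFDRep.Iso.piTensor e fun j =>
    Ψ.comap_ev_iso (hf j) (ρ (f j)) (σ j) (hρ _) (hσ _)

/-- `ev_Ψ` is the class of the evaluation representation attached to any representatives of the
orbits in the support of `Ψ` and any representations in the classes `Ψ(xᵢ)`. -/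
theorem evClass_eq (Ψ : D.ClassFun) {n : ℕ} {x : Fin n → RatPoint k A} (hx : Ψ.IsTransversal x)
    (ρ : ∀ i, LieFDRep.{u, w, u} k (D.isotropy (x i)))
    (hρ : ∀ i, LieRepClass.mk (ρ i) = Ψ.toFun (x i)) :
    Ψ.evClass = LieRepClass.mk (D.evRep x ρ) :=
  LieRepClass.mk_eq_mk.2 (Ψ.evRep_iso Ψ.exists_isTransversal.choose_spec.choose_spec hx _ ρ
    (fun _ => Quotient.out_eq _) hρ)

end ClassFun

end EquivariantPair

end

/-! Irreducibility. For points $x_1,\dots,x_n$ in distinct orbits, evaluation maps $\mathfrak M$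
onto $\prod_i\mathfrak g^{x_i}$: average $f_i\otimes u$ over $\Gamma$, where $f_i$ is $1$ at $x_i$
and $0$ at the other points of these orbits (`exists_ev_section`). By Burnside's theorem a tensor
product of irreducibles of the factors is irreducible for the product, so evaluation representations
and their twists by characters are irreducible (`isIrreducible_evRep`).

Surjectivity. Twisting by minus the normalised trace makes an irreducible $V$ traceless. The kernel
$K$ of $\mathfrak M\to\operatorname{End}V$ is then stable under $A^\Gamma$: if $\alpha\in K$, then
$[a\alpha,\beta]=[\alpha,a\beta]$ acts by zero, so $a\alpha$ acts by a scalar, which has trace zero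
and vanishes (`smulEnd_mem_ker`). Hence an ideal $I\subseteq A^\Gamma$ of finite codimension
annihilates $\mathfrak M/K$ (`exists_ideal`). Invariants separate orbits, so finitely many orbits
lie over $I$; since $A$ is integral over $A^\Gamma$, a function vanishing on them lies in the
radical of $IA$ (`mem_radical_of_forall_point`). Finitely many such functions generate an ideal $J$
with a power inside $IA$. The image of $\mathfrak M$ in $\operatorname{End}V$ has zero radical,
being finite-dimensional, traceless and irreducible on $V$; the elements vanishing at the chosen
points map to an ideal of it whose $m$-th derived term comes from $J^{2^m}\otimes\mathfrak g$, which
acts by zero for large $m$. That ideal is solvable, hence zero, and $V$ factors through the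
evaluations (`exists_points_of_traceless`). An irreducible representation of a finite product is a
tensor product of irreducibles of the factors (`exists_irreducible_multilinear`,
`evRep_iso_of_multilinear`).

Fibres. Compute $\lambda\otimes\mathrm{ev}_\Psi\cong\lambda'\otimes\mathrm{ev}_{\Psi'}$ at common
orbit representatives. An element killed by all evaluations acts by $\lambda$ on one side and
$\lambda'$ on the other, so $\lambda-\lambda'=\sum_i\varphi_i\circ\mathrm{ev}_{x_i}$. An element
with a single nonzero value acts in one tensor slot; freezing the other slots gives
$\rho'_i\cong\varphi_i\otimes\rho_i$ (`exists_characters`), and the $\varphi_i$ assemble into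
$\Phi$. Conversely, a character $\sum_i\varphi_i\circ\mathrm{ev}_{x_i}$ can be distributed over the
slots (`twist_evRep_iso`). If $\lambda=\lambda'$, all $\varphi_i$ vanish, which is injectivity in
$\Psi$. -/

noncomputable section

/-! ### Characters of a Lie algebra -/

namespace AbDual

variable {k : Type u} [Field k] {L : Type v} [LieRing L] [LieAlgebra k L]

/-- The character of `L` underlying an element of `(L / [L, L])^*`. -/
def eval (lam : AbDual k L) : L →ₗ[k] k :=
  lam ∘ₗ ((LieSubmodule.Quotient.mk' ⁅(⊤ : LieIdeal k L), (⊤ : LieIdeal k L)⁆ :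
        L →ₗ⁅k,L⁆ L ⧸ ⁅(⊤ : LieIdeal k L), (⊤ : LieIdeal k L)⁆) :
        L →ₗ[k] L ⧸ ⁅(⊤ : LieIdeal k L), (⊤ : LieIdeal k L)⁆)

theorem eval_lie (lam : AbDual k L) (x y : L) : lam.eval ⁅x, y⁆ = 0 := by
  have h : (LieSubmodule.Quotient.mk ⁅x, y⁆ :
      L ⧸ ⁅(⊤ : LieIdeal k L), (⊤ : LieIdeal k L)⁆) = 0 :=
    (LieSubmodule.Quotient.mk_eq_zero').2
      (LieSubmodule.lie_mem_lie (LieSubmodule.mem_top x) (LieSubmodule.mem_top y))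
  change lam (LieSubmodule.Quotient.mk ⁅x, y⁆) = 0
  rw [h, map_zero]

theorem eval_injective : Function.Injective (eval : AbDual k L → L →ₗ[k] k) := by
  intro a b h
  refine LinearMap.ext fun x => ?_
  obtain ⟨y, rfl⟩ := LieSubmodule.Quotient.surjective_mk' _ x
  exact LinearMap.congr_fun h y

theorem eval_neg (a : AbDual k L) : (-a : AbDual k L).eval = -a.eval := rfl

theorem eval_sub (a b : AbDual k L) : (a - b : AbDual k L).eval = a.eval - b.eval := rfl

theorem exists_eval_eq (φ : L →ₗ[k] k) (h : ∀ x y : L, φ ⁅x, y⁆ = 0) :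
    ∃ lam : AbDual k L, lam.eval = φ := by
  have hle : (⁅(⊤ : LieIdeal k L), (⊤ : LieIdeal k L)⁆ : LieIdeal k L).toSubmodule ≤
      LinearMap.ker φ := by
    rw [LieSubmodule.lieIdeal_oper_eq_linear_span', Submodule.span_le]
    rintro _ ⟨x, _, y, _, rfl⟩
    exact h x y
  exact ⟨Submodule.liftQ _ φ hle, LinearMap.ext fun x => rfl⟩

end AbDual

/-! ### Schur's lemma, twists by characters, one-dimensional representations -/

namespace LieFDRep

variable {k : Type u} [Field k] {L : Type v} [LieRing L] [LieAlgebra k L]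

theorem isIrreducible_iff (ρ : LieFDRep.{u, v, w} k L) :
    ρ.IsIrreducible ↔ Nontrivial ρ.carrier ∧ ∀ W : Submodule k ρ.carrier,
      (∀ (x : L), ∀ m ∈ W, ⁅x, m⁆ ∈ W) → W = ⊥ ∨ W = ⊤ := by
  constructor
  · intro h
    have : LieModule.IsIrreducible k L ρ.carrier := h
    refine ⟨LieModule.nontrivial_of_isIrreducible k L ρ.carrier, fun W hW => ?_⟩
    let N : LieSubmodule k L ρ.carrier := { W with lie_mem := fun {x m} hm => hW x m hm }
    rcases eq_bot_or_eq_top N with h | h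
    · exact Or.inl (by simpa [N] using congrArg LieSubmodule.toSubmodule h)
    · exact Or.inr (by simpa [N] using congrArg LieSubmodule.toSubmodule h)
  · rintro ⟨_, h⟩
    refine LieModule.IsIrreducible.mk fun N hN => ?_
    rcases h N.toSubmodule (fun x m hm => N.lie_mem hm) with h | h
    · exact absurd ((LieSubmodule.toSubmodule_eq_bot N).1 h) hN
    · exact (LieSubmodule.toSubmodule_eq_top N).1 h

/-- Schur's lemma: the kernel and the range of an intertwiner are subrepresentations. -/
theorem IsIrreducible.iso_of_ne_zero {ρ : LieFDRep.{u, v, w₁} k L} {σ : LieFDRep.{u, v, w₂} k L}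
    (hρ : ρ.IsIrreducible) (hσ : σ.IsIrreducible) (f : ρ.carrier →ₗ[k] σ.carrier)
    (hf : ∀ (x : L) m, f ⁅x, m⁆ = ⁅x, f m⁆) (hne : f ≠ 0) : ρ.Iso σ := by
  have hker : LinearMap.ker f = ⊥ := by
    refine (((isIrreducible_iff ρ).1 hρ).2 (LinearMap.ker f) fun x m hm => ?_).resolve_right
      fun h => hne (LinearMap.ker_eq_top.1 h)
    rw [LinearMap.mem_ker] at hm ⊢
    rw [hf, hm, lie_zero]
  have hrange : LinearMap.range f = ⊤ := by
    refine (((isIrreducible_iff σ).1 hσ).2 (LinearMap.range f) ?_).resolve_left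
      fun h => hne (LinearMap.range_eq_bot.1 h)
    rintro x _ ⟨m, rfl⟩
    exact ⟨⁅x, m⁆, hf x m⟩
  exact Iso.of_linearEquiv (LinearEquiv.ofBijective f
    ⟨LinearMap.ker_eq_bot.1 hker, LinearMap.range_eq_top.1 hrange⟩) hf

/-- Schur's lemma over an algebraically closed field: an eigenspace of an intertwiner is a nonzero
subrepresentation. -/
theorem IsIrreducible.exists_eq_smul [IsAlgClosed k] {ρ : LieFDRep.{u, v, w} k L}
    (hρ : ρ.IsIrreducible) (f : Module.End k ρ.carrier)
    (hf : ∀ (x : L) m, f ⁅x, m⁆ = ⁅x, f m⁆) : ∃ c : k, ∀ m, f m = c • m := by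
  obtain ⟨hn, h⟩ := (isIrreducible_iff ρ).1 hρ
  obtain ⟨c, hc⟩ := Module.End.exists_eigenvalue f
  refine ⟨c, fun m => ?_⟩
  have htop : Module.End.eigenspace f c = ⊤ := by
    refine (h _ fun x m hm => ?_).resolve_left hc
    rw [Module.End.mem_eigenspace_iff] at hm ⊢
    rw [hf, hm, lie_smul]
  exact Module.End.mem_eigenspace_iff.1 (htop ▸ Submodule.mem_top)

/-- The representation `lam ⊗ ρ`, realized on the space of `ρ`. -/
def twist (lam : AbDual k L) (ρ : LieFDRep.{u, v, w} k L) : LieFDRep.{u, v, w} k L :=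
  ofLinear ρ.carrier
    ((LieModule.toEnd k L ρ.carrier : L →ₗ[k] Module.End k ρ.carrier) +
      (LinearMap.lsmul k ρ.carrier : k →ₗ[k] Module.End k ρ.carrier) ∘ₗ lam.eval)
    (by
      intro x y
      ext m
      simp only [LinearMap.add_apply, LinearMap.comp_apply, lam.eval_lie, map_zero, add_zero,
        LieHom.coe_toLinearMap, LieModule.toEnd_apply_apply, lie_lie, LinearMap.sub_apply,
        Module.End.mul_apply, LinearMap.lsmul_apply, lie_add, lie_smul, smul_add, smul_smul,
        mul_comm (lam.eval y)]
      abel)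

theorem Iso.of_tensor {ρ : LieFDRep.{u, v, w₁} k L} {σ : LieFDRep.{u, v, w₂} k L}
    {τ : LieFDRep.{u, v, w₃} k L} (e : ρ.carrier ⊗[k] σ.carrier ≃ₗ[k] τ.carrier)
    (h : ∀ (x : L) a b, e (⁅x, a⁆ ⊗ₜ b + a ⊗ₜ ⁅x, b⁆) = ⁅x, e (a ⊗ₜ b)⁆) :
    (ρ.tensor σ).Iso τ := by
  refine Iso.of_linearEquiv (ρ := ρ.tensor σ) (σ := τ) e fun x m => ?_
  change ρ.carrier ⊗[k] σ.carrier at m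
  change e ⁅x, m⁆ = ⁅x, e m⁆
  induction m with
  | zero => simp
  | tmul a b => rw [TensorProduct.LieModule.lie_tmul_right, h]
  | add a b ha hb => simp [ha, hb]

theorem oneDim_tensor_iso (lam : AbDual k L) (ρ : LieFDRep.{u, v, w} k L) :
    ((oneDim lam).tensor ρ).Iso (twist lam ρ) := by
  refine Iso.of_tensor (ρ := oneDim lam) (σ := ρ) (τ := twist lam ρ)
    (TensorProduct.lid k ρ.carrier : k ⊗[k] ρ.carrier ≃ₗ[k] ρ.carrier) fun x a b => ?_
  change k at a
  change (TensorProduct.lid k ρ.carrier : k ⊗[k] ρ.carrier ≃ₗ[k] ρ.carrier)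
    ((lam.eval x * a) ⊗ₜ[k] b + a ⊗ₜ[k] ⁅x, b⁆) = (⁅x, a • b⁆ + lam.eval x • (a • b) : ρ.carrier)
  simp [smul_smul, add_comm]

theorem tensor_oneDim_iso (lam : AbDual k L) (ρ : LieFDRep.{u, v, w} k L) :
    (ρ.tensor (oneDim lam)).Iso (twist lam ρ) := by
  refine Iso.of_tensor (ρ := ρ) (σ := oneDim lam) (τ := twist lam ρ)
    (TensorProduct.rid k ρ.carrier : ρ.carrier ⊗[k] k ≃ₗ[k] ρ.carrier) fun x a b => ?_
  change k at b
  change (TensorProduct.rid k ρ.carrier : ρ.carrier ⊗[k] k ≃ₗ[k] ρ.carrier)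
    (⁅x, a⁆ ⊗ₜ[k] b + a ⊗ₜ[k] (lam.eval x * b)) = (⁅x, b • a⁆ + lam.eval x • (b • a) : ρ.carrier)
  simp [smul_smul]

theorem twist_zero_iso (ρ : LieFDRep.{u, v, w} k L) : (twist 0 ρ).Iso ρ :=
  Iso.of_linearEquiv (ρ := twist 0 ρ) (σ := ρ) (LinearEquiv.refl k ρ.carrier) fun x m => by
    change ρ.carrier at m
    change (⁅x, m⁆ + (0 : k) • m : ρ.carrier) = ⁅x, m⁆
    rw [zero_smul, add_zero]

theorem twist_twist_iso (lam mu : AbDual k L) (ρ : LieFDRep.{u, v, w} k L) :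
    (twist lam (twist mu ρ)).Iso (twist (lam + mu : AbDual k L) ρ) :=
  Iso.of_linearEquiv (ρ := twist lam (twist mu ρ)) (σ := twist (lam + mu : AbDual k L) ρ)
    (LinearEquiv.refl k ρ.carrier) fun x m => by
    change ρ.carrier at m
    change (⁅x, m⁆ + mu.eval x • m + lam.eval x • m : ρ.carrier) =
      ⁅x, m⁆ + (lam.eval x + mu.eval x) • m
    rw [add_smul, add_assoc, add_comm (mu.eval x • m)]

theorem Iso.twist {ρ : LieFDRep.{u, v, w₁} k L} {σ : LieFDRep.{u, v, w₂} k L} (h : ρ.Iso σ)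
    (lam : AbDual k L) : (twist lam ρ).Iso (LieFDRep.twist lam σ) := by
  obtain ⟨e, he⟩ := h.exists_linearEquiv
  refine Iso.of_linearEquiv (ρ := LieFDRep.twist lam ρ) (σ := LieFDRep.twist lam σ) e fun x m => ?_
  change ρ.carrier at m
  change e (⁅x, m⁆ + lam.eval x • m) = ⁅x, e m⁆ + lam.eval x • e m
  rw [map_add, map_smul, he]

theorem IsIrreducible.twist {ρ : LieFDRep.{u, v, w} k L} (h : ρ.IsIrreducible)
    (lam : AbDual k L) : (LieFDRep.twist lam ρ).IsIrreducible := by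
  rw [isIrreducible_iff] at h ⊢
  refine ⟨h.1, fun W hW => h.2 W fun x m hm => ?_⟩
  have h1 : (⁅x, m⁆ + lam.eval x • m : ρ.carrier) ∈ (W : Submodule k ρ.carrier) := hW x m hm
  have h2 : (⁅x, m⁆ + lam.eval x • m - lam.eval x • m : ρ.carrier) ∈ (W : Submodule k ρ.carrier) :=
    sub_mem h1 (Submodule.smul_mem (W : Submodule k ρ.carrier) (lam.eval x) hm)
  rwa [add_sub_cancel_right] at h2

theorem isIrreducible_of_dim_eq_one {ρ : LieFDRep.{u, v, w} k L} (h : ρ.dim = 1) :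
    ρ.IsIrreducible := by
  have h' : Module.finrank k ρ.carrier = 1 := h
  refine (isIrreducible_iff ρ).2 ⟨Module.nontrivial_of_finrank_eq_succ h', fun W _ => ?_⟩
  have := is_simple_module_of_finrank_eq_one (A := k) h'
  exact eq_bot_or_eq_top W

theorem dim_oneDim (lam : AbDual k L) : (oneDim lam).dim = 1 :=
  Module.finrank_self k

theorem exists_oneDim_iso {ρ : LieFDRep.{u, v, w} k L} (h : ρ.dim = 1) :
    ∃ lam : AbDual k L, (oneDim lam).Iso ρ := by
  have h' : Module.finrank k ρ.carrier = 1 := h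
  obtain ⟨v, hv, hspan⟩ := finrank_eq_one_iff'.1 h'
  choose c hc using hspan
  have key : ∀ {a b : k}, a • v = b • v → a = b := fun h => smul_left_injective k hv h
  have hcx : ∀ (x : L), c ⁅x, v⁆ • v = ⁅x, v⁆ := fun x => hc _
  obtain ⟨lam, hlam⟩ := AbDual.exists_eval_eq (L := L)
    { toFun := fun x => c ⁅x, v⁆
      map_add' := fun x y => key (by rw [hcx, add_lie, add_smul, hcx, hcx])
      map_smul' := fun t x => key (by
        rw [hc, RingHom.id_apply, smul_lie, smul_assoc, hcx]) }
    (fun x y => key (by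
      change c ⁅⁅x, y⁆, v⁆ • v = _
      -- On a line the operators are scalars and commute, so brackets act by zero.
      have h1 : ∀ a b : L, ⁅a, ⁅b, v⁆⁆ = (c ⁅b, v⁆ * c ⁅a, v⁆) • v := fun a b => by
        conv_lhs => rw [← hcx b, lie_smul, ← hcx a, smul_smul]
      rw [hcx, lie_lie, h1, h1, mul_comm, sub_self, zero_smul]))
  refine ⟨lam, Iso.of_linearEquiv (ρ := oneDim lam) (σ := ρ)
    (LinearEquiv.ofBijective (LinearMap.toSpanSingleton k ρ.carrier v)
      ⟨fun a b h => key h, fun w => ⟨c w, hc w⟩⟩) fun x m => ?_⟩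
  change k at m
  change (lam.eval x * m) • v = ⁅x, m • v⁆
  rw [hlam, lie_smul, ← hcx x]
  simp [smul_smul, mul_comm]

theorem oneDim_injective {lam mu : AbDual k L} (h : (oneDim lam).Iso (oneDim mu)) : lam = mu := by
  obtain ⟨e, he⟩ := h.exists_linearEquiv
  change k ≃ₗ[k] k at e
  refine AbDual.eval_injective (LinearMap.ext fun x => ?_)
  have h1 : e (lam.eval x * 1) = mu.eval x * e 1 := he x (1 : k)
  rw [← smul_eq_mul, map_smul, smul_eq_mul] at h1
  exact mul_right_cancel₀ (fun h0 => one_ne_zero (e.injective (h0.trans (map_zero e).symm))) h1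

/-- Every finite-dimensional representation is isomorphic to one in the universe of the field. -/
theorem exists_iso_small (ρ : LieFDRep.{u, v, w} k L) : ∃ σ : LieFDRep.{u, v, u} k L, ρ.Iso σ := by
  let b := Module.finBasis k ρ.carrier
  let e : ρ.carrier ≃ₗ[k] (Fin (Module.finrank k ρ.carrier) → k) := b.equivFun
  let σ : LieFDRep.{u, v, u} k L := ofLinear (Fin (Module.finrank k ρ.carrier) → k)
    ((e.conj : Module.End k ρ.carrier →ₗ[k] _) ∘ₗ
      (LieModule.toEnd k L ρ.carrier : L →ₗ[k] Module.End k ρ.carrier)) (by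
    intro x y
    refine LinearMap.ext fun m => ?_
    simp [LinearEquiv.conj_apply, Ring.lie_def])
  refine ⟨σ, Iso.of_linearEquiv (ρ := ρ) (σ := σ) e fun x m => ?_⟩
  change e ⁅x, m⁆ = e.conj (LieModule.toEnd k L ρ.carrier x) (e m)
  simp [LinearEquiv.conj_apply]

end LieFDRep

namespace LieRepClass

variable {k : Type u} [Field k] {L : Type v} [LieRing L] [LieAlgebra k L]

theorem isIrreducible_mk {ρ : LieFDRep.{u, v, u} k L} :
    (mk ρ).IsIrreducible ↔ ρ.IsIrreducible := Iff.rfl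

theorem ofDual_tensor_mk (lam : AbDual k L) (ρ : LieFDRep.{u, v, u} k L) :
    (ofDual lam).tensor (mk ρ) = mk (LieFDRep.twist lam ρ) :=
  mk_eq_mk.2 (LieFDRep.oneDim_tensor_iso lam ρ)

theorem mk_tensor_ofDual (lam : AbDual k L) (ρ : LieFDRep.{u, v, u} k L) :
    (mk ρ).tensor (ofDual lam) = mk (LieFDRep.twist lam ρ) := by
  exact mk_eq_mk.2 (LieFDRep.tensor_oneDim_iso lam ρ)

theorem exists_eq_mk (c : LieRepClass k L) : ∃ ρ, mk ρ = c := Quotient.exists_rep c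

theorem ofDual_injective : Function.Injective (ofDual : AbDual k L → LieRepClass k L) :=
  fun _ _ h => LieFDRep.oneDim_injective (mk_eq_mk.1 h)

theorem dim_ofDual (lam : AbDual k L) : (ofDual lam).dim = 1 := LieFDRep.dim_oneDim lam

theorem exists_ofDual_eq {c : LieRepClass k L} (h : c.dim = 1) : ∃ lam, ofDual lam = c := by
  obtain ⟨ρ, rfl⟩ := exists_eq_mk c
  obtain ⟨lam, hlam⟩ := LieFDRep.exists_oneDim_iso (ρ := ρ) h
  exact ⟨lam, mk_eq_mk.2 hlam⟩

theorem isIrreducible_ofDual (lam : AbDual k L) : (ofDual lam).IsIrreducible :=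
  LieFDRep.isIrreducible_of_dim_eq_one (LieFDRep.dim_oneDim lam)

end LieRepClass

/-! ### Burnside's theorem and operators on tensor products -/

/-- Burnside's theorem: a set of operators without proper nonzero invariant subspaces generates
the whole algebra of endomorphisms. -/
theorem Module.End.adjoin_eq_top_of_irreducible {k V : Type*} [Field k] [IsAlgClosed k]
    [AddCommGroup V] [Module k V] [FiniteDimensional k V] [Nontrivial V]
    (S : Set (Module.End k V))
    (h : ∀ W : Submodule k V, (∀ f ∈ S, ∀ m ∈ W, f m ∈ W) → W = ⊥ ∨ W = ⊤) :
    Algebra.adjoin k S = ⊤ := by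
  set B := Algebra.adjoin k S with hB
  have hsmul : ∀ (b : B) (m : V), b • m = b.1 m := fun _ _ => rfl
  have hinv : ∀ N : Submodule B V, N = ⊥ ∨ N = ⊤ := by
    intro N
    rcases h (N.restrictScalars k) (fun f hf m hm =>
      N.smul_mem ⟨f, Algebra.subset_adjoin hf⟩ hm) with h | h
    · exact Or.inl ((Submodule.restrictScalars_eq_bot_iff _ _ _).1 h)
    · exact Or.inr ((Submodule.restrictScalars_eq_top_iff _ _ _).1 h)
  have : IsSimpleModule B V := { toIsSimpleOrder := { eq_bot_or_eq_top := hinv } }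
  -- Schur again: the commutant of `B` consists of scalars, so every `k`-linear `f` commutes with it
  -- and the density theorem applies to `f`.
  have hscalar : ∀ g : Module.End B V, ∃ c : k, ∀ m, g m = c • m := by
    intro g
    let g' : Module.End k V := g.restrictScalars k
    obtain ⟨c, hc⟩ := Module.End.exists_eigenvalue g'
    refine ⟨c, fun m => ?_⟩
    have htop : Module.End.eigenspace g' c = ⊤ := by
      refine (h _ fun f hf m hm => ?_).resolve_left hc
      rw [Module.End.mem_eigenspace_iff] at hm ⊢
      have h1 : g' (f m) = f (g' m) := g.map_smul (⟨f, Algebra.subset_adjoin hf⟩ : B) m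
      rw [h1, hm, map_smul]
    exact Module.End.mem_eigenspace_iff.1 (htop ▸ Submodule.mem_top : m ∈ g'.eigenspace c)
  refine eq_top_iff.2 fun f _ => ?_
  let F : Module.End (Module.End B V) V :=
    { toFun := f
      map_add' := map_add f
      map_smul' := fun g m => by
        obtain ⟨c, hc⟩ := hscalar g
        simp [hc] }
  -- Density yields an element of `B` agreeing with `f` on a finite set; a spanning set makes them
  -- equal.
  obtain ⟨s, hs⟩ := Module.Finite.fg_top (R := k) (M := V)
  obtain ⟨r, hr⟩ := jacobson_density F s
  have : f = r.1 := LinearMap.ext_on hs fun m hm => hr m hm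
  rw [this]
  exact r.2

namespace PiTensorProduct

variable {k : Type*} [Field k] {ι : Type*}
  {V : ι → Type*} [∀ i, AddCommGroup (V i)] [∀ i, Module k (V i)]

theorem mapMonoidHom_mulSingle_tprod [DecidableEq ι] (i : ι) (a : Module.End k (V i)) (x : ∀ i, V i) :
    mapMonoidHom (Pi.mulSingle i a) (tprod k x) = tprod k (Function.update x i (a (x i))) := by
  rw [mapMonoidHom_apply, map_tprod]
  congr 1
  funext j
  by_cases h : j = i
  · subst h; simp
  · simp [h]

/-- `Pi.mulSingle i f` is the identity family updated at `i`, so the multilinearity of `map` in the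
operators gives linearity in the single slot. -/
theorem mapMonoidHom_mulSingle_add [DecidableEq ι] (i : ι) (f g : Module.End k (V i)) :
    mapMonoidHom (R := k) (s := V) (Pi.mulSingle i (f + g)) =
      mapMonoidHom (Pi.mulSingle i f) + mapMonoidHom (Pi.mulSingle i g) :=
  map_add ((mapMultilinear k V V).toLinearMap (fun _ => LinearMap.id) i) f g

theorem mapMonoidHom_mulSingle_smul_one [DecidableEq ι] (i : ι) (c : k) :
    mapMonoidHom (R := k) (s := V) (Pi.mulSingle i (c • (1 : Module.End k (V i)))) = c • 1 := by
  refine (map_smul ((mapMultilinear k V V).toLinearMap (fun _ => LinearMap.id) i) c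
    (1 : Module.End k (V i))).trans ?_
  change c • mapMonoidHom (R := k) (s := V) (Pi.mulSingle i (1 : Module.End k (V i))) = _
  rw [Pi.mulSingle_one, map_one]

theorem mapMonoidHom_mulSingle_zero [DecidableEq ι] (i : ι) :
    mapMonoidHom (R := k) (s := V) (Pi.mulSingle i (0 : Module.End k (V i))) = 0 :=
  map_zero ((mapMultilinear k V V).toLinearMap (fun _ => LinearMap.id) i)

variable [Fintype ι]

/-- A nonzero vector has a nonzero coordinate `p`; the tensor product of the rank-one operators
$v\mapsto v_{p_i}m_i$ sends it to a nonzero multiple of the pure tensor of an arbitrary `m`. -/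
theorem eq_bot_or_eq_top_of_map_mem (W : Submodule k (⨂[k] i, V i))
    (h : ∀ f : ∀ i, Module.End k (V i), ∀ w ∈ W, map f w ∈ W) : W = ⊥ ∨ W = ⊤ := by
  refine or_iff_not_imp_left.2 fun hW => ?_
  obtain ⟨w, hw, hne⟩ := (Submodule.ne_bot_iff W).1 hW
  let b := fun i => Module.Basis.ofVectorSpace k (V i)
  let B := Basis.piTensorProduct b
  obtain ⟨p, hp⟩ : ∃ p, B.repr w p ≠ 0 := by
    by_contra! h0
    exact hne (B.repr.map_eq_zero_iff.1 (Finsupp.ext h0))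
  have key : ∀ (m : ∀ i, V i) (z : ⨂[k] i, V i),
      map (fun i => ((b i).coord (p i)).smulRight (m i)) z = B.repr z p • tprod k m := by
    intro m z
    induction z using PiTensorProduct.induction_on with
    | smul_tprod r x =>
      rw [map_smul, map_tprod, map_smul, Finsupp.smul_apply,
        Basis.piTensorProduct_repr_tprod_apply]
      simp only [LinearMap.smulRight_apply, Module.Basis.coord_apply]
      rw [MultilinearMap.map_smul_univ, smul_assoc]
    | add x y hx hy => rw [map_add, hx, hy, map_add, Finsupp.add_apply, add_smul]
  rw [eq_top_iff, ← span_tprod_eq_top, Submodule.span_le]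
  rintro _ ⟨m, rfl⟩
  have h1 := h (fun i => ((b i).coord (p i)).smulRight (m i)) w hw
  rw [key] at h1
  exact (Submodule.smul_mem_iff W hp).1 h1

variable [DecidableEq ι]

/-- Burnside upgrades invariance under `S i` in slot `i` to invariance under all operators in that
slot, and products of one-slot operators are all the operators `map f`. -/
theorem eq_bot_or_eq_top_of_irreducible [IsAlgClosed k] [∀ i, FiniteDimensional k (V i)]
    [∀ i, Nontrivial (V i)] (S : ∀ i, Set (Module.End k (V i)))
    (hS : ∀ i, ∀ U : Submodule k (V i), (∀ f ∈ S i, ∀ m ∈ U, f m ∈ U) → U = ⊥ ∨ U = ⊤)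
    (W : Submodule k (⨂[k] i, V i))
    (h : ∀ i, ∀ f ∈ S i, ∀ w ∈ W, mapMonoidHom (Pi.mulSingle i f) w ∈ W) : W = ⊥ ∨ W = ⊤ := by
  have hsingle : ∀ i, ∀ f : Module.End k (V i), ∀ w ∈ W,
      mapMonoidHom (Pi.mulSingle i f) w ∈ W := by
    intro i f
    have hf : f ∈ Algebra.adjoin k (S i) := by
      rw [Module.End.adjoin_eq_top_of_irreducible (S i) (hS i)]
      trivial
    induction hf using Algebra.adjoin_induction with
    | mem f hf => exact h i f hf
    | algebraMap c =>
      intro w hw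
      rw [Algebra.algebraMap_eq_smul_one, mapMonoidHom_mulSingle_smul_one]
      exact W.smul_mem c hw
    | add f g _ _ hf hg =>
      intro w hw
      rw [mapMonoidHom_mulSingle_add]
      exact W.add_mem (hf w hw) (hg w hw)
    | mul f g _ _ hf hg =>
      intro w hw
      rw [Pi.mulSingle_mul, map_mul]
      exact hf _ (hg w hw)
  refine eq_bot_or_eq_top_of_map_mem W fun f => ?_
  -- The one-slot operators only commute pairwise inside a noncommutative monoid, so a family is
  -- reassembled from them by `Finset.noncommProd`.
  let P : Submonoid (∀ i, Module.End k (V i)) :=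
    { carrier := {f | ∀ w ∈ W, mapMonoidHom f w ∈ W}
      one_mem' := fun w hw => by rw [map_one]; exact hw
      mul_mem' := fun {f g} hf hg w hw => by rw [map_mul]; exact hf _ (hg w hw) }
  have : f ∈ P := by
    rw [← Finset.noncommProd_mulSingle f]
    exact Submonoid.noncommProd_mem P _ _ _ fun i _ => hsingle i (f i)
  exact this

/-- Freeze all slots but `i` at a vector in the source, and contract all slots but `i` with basis
covectors in the target. Both operations commute with operators in slot `i`, so one and the same `φ`
intertwines every pair `(a, b)` that `e` intertwines. -/
theorem exists_linearMap_ne_zero {V' : ι → Type*} [∀ i, AddCommGroup (V' i)]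
    [∀ i, Module k (V' i)] [∀ i, FiniteDimensional k (V' i)]
    (e : (⨂[k] i, V i) →ₗ[k] ⨂[k] i, V' i) (he : e ≠ 0) (i : ι) :
    ∃ φ : V i →ₗ[k] V' i, φ ≠ 0 ∧ ∀ (a : Module.End k (V i)) (b : Module.End k (V' i)),
      (∀ z, e (mapMonoidHom (Pi.mulSingle i a) z) = mapMonoidHom (Pi.mulSingle i b) (e z)) →
      ∀ v, φ (a v) = b (φ v) := by
  obtain ⟨m, hm⟩ : ∃ m, e (tprod k m) ≠ 0 := by
    by_contra! h
    exact he (PiTensorProduct.ext (MultilinearMap.ext h))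
  let b := fun i => Module.finBasis k (V' i)
  let B := Basis.piTensorProduct b
  obtain ⟨p, hp⟩ : ∃ p, B.repr (e (tprod k m)) p ≠ 0 := by
    by_contra! h0
    exact hm (B.repr.map_eq_zero_iff.1 (Finsupp.ext h0))
  -- Contraction of every slot `j ≠ i` with the `p j`-th coordinate; the value `p i` is overwritten
  -- by `q` and plays no role here.
  let C : (⨂[k] i, V' i) →ₗ[k] V' i :=
    ∑ q, (B.coord (Function.update p i q)).smulRight (b i q)
  have hC : ∀ x : ∀ i, V' i, C (tprod k x) =
      (∏ j ∈ Finset.univ.erase i, (b j).repr (x j) (p j)) • x i := by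
    intro x
    simp only [C, LinearMap.sum_apply, LinearMap.smulRight_apply, Module.Basis.coord_apply, B,
      Basis.piTensorProduct_repr_tprod_apply]
    conv_rhs => rw [← (b i).sum_repr (x i), Finset.smul_sum]
    refine Finset.sum_congr rfl fun q _ => ?_
    rw [smul_smul, ← Finset.mul_prod_erase _ _ (Finset.mem_univ i), mul_comm,
      Function.update_self]
    congr 2
    exact Finset.prod_congr rfl fun j hj => by
      rw [Function.update_of_ne (Finset.ne_of_mem_erase hj)]
  have hCb : ∀ (a : Module.End k (V' i)) z,
      C (mapMonoidHom (Pi.mulSingle i a) z) = a (C z) := by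
    intro a z
    induction z using PiTensorProduct.induction_on with
    | smul_tprod r x =>
      rw [map_smul, map_smul, map_smul, map_smul, mapMonoidHom_mulSingle_tprod, hC, hC, Function.update_self, map_smul]
      congr 2
      exact Finset.prod_congr rfl fun j hj => by
        rw [Function.update_of_ne (Finset.ne_of_mem_erase hj)]
    | add x y hx hy => simp only [map_add, hx, hy]
  -- The `p i`-th coordinate of `φ (m i)` is the `p`-th coordinate of `e (tprod k m)`, which was
  -- chosen nonzero.
  refine ⟨C ∘ₗ e ∘ₗ (tprod k).toLinearMap m i, fun h0 => hp ?_, fun a b' hab v => ?_⟩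
  · have h1 := LinearMap.congr_fun h0 (m i)
    simp only [LinearMap.comp_apply, MultilinearMap.toLinearMap_apply, Function.update_eq_self,
      LinearMap.zero_apply] at h1
    have h2 := congrArg (fun z => (b i).repr z (p i)) h1
    simp only [C, LinearMap.sum_apply, LinearMap.smulRight_apply, map_sum, map_smul,
      Module.Basis.repr_self, Finsupp.coe_finsetSum, Finset.sum_apply, Finsupp.smul_apply,
      Finsupp.single_apply, smul_eq_mul, mul_ite, mul_one, mul_zero, Finset.sum_ite_eq',
      Finset.mem_univ, if_true, Function.update_eq_self, map_zero, Finsupp.zero_apply,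
      Module.Basis.coord_apply] at h2
    exact h2
  · simp only [LinearMap.comp_apply, MultilinearMap.toLinearMap_apply]
    have h1 := hab (tprod k (Function.update m i v))
    rw [mapMonoidHom_mulSingle_tprod, Function.update_self, Function.update_idem] at h1
    rw [h1, hCb]

end PiTensorProduct

/-! ### Irreducible constituents of commuting actions -/

namespace LieFDRep

variable {k : Type u} [Field k]

/-- Finite dimension provides a minimal nonzero submodule; `f` is its inclusion. -/
theorem exists_irreducible_sub {L : Type v} [LieRing L] [LieAlgebra k L]
    (ρ : LieFDRep.{u, v, w} k L) [Nontrivial ρ.carrier] :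
    ∃ (σ : LieFDRep.{u, v, w} k L) (f : σ.carrier →ₗ[k] ρ.carrier), σ.IsIrreducible ∧ f ≠ 0 ∧
      ∀ (x : L) m, f ⁅x, m⁆ = ⁅x, f m⁆ := by
  obtain ⟨N, hN, -⟩ := (eq_bot_or_exists_atom_le (⊤ : LieSubmodule k L ρ.carrier)).resolve_left
    top_ne_bot
  obtain ⟨m, hm, hm0⟩ := (Submodule.ne_bot_iff N.toSubmodule).1
    (fun h => hN.1 ((LieSubmodule.toSubmodule_eq_bot N).1 h))
  let σ : LieFDRep.{u, v, w} k L := { carrier := N }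
  refine ⟨σ, N.toSubmodule.subtype, (isIrreducible_iff σ).2 ⟨⟨⟨m, hm⟩, 0, fun h => hm0
    (congrArg Subtype.val h)⟩, fun W hW => ?_⟩, fun h => hm0 ?_, fun x m => rfl⟩
  · change Submodule k N at W
    let N' : LieSubmodule k L ρ.carrier :=
      { W.map N.toSubmodule.subtype with
        lie_mem := by
          rintro x _ ⟨m, hm, rfl⟩
          exact ⟨(⁅x, (show N from m)⁆ : N), hW x m hm, rfl⟩ }
    have hle : N' ≤ N := by
      rintro _ ⟨m, _, rfl⟩
      exact m.2
    rcases hN.le_iff.1 hle with h | h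
    · left
      rw [← LieSubmodule.toSubmodule_eq_bot] at h
      refine (Submodule.eq_bot_iff _).2 fun m hm => Subtype.ext ?_
      have h1 : (m : ρ.carrier) ∈ W.map N.toSubmodule.subtype := ⟨m, hm, rfl⟩
      exact (Submodule.mem_bot k).1 ((congrArg (fun P => (m : ρ.carrier) ∈ P) h).mp h1)
    · right
      refine eq_top_iff.2 fun (n : N) _ => ?_
      have hn : (n : ρ.carrier) ∈ N' := by rw [h]; exact n.2
      obtain ⟨n', hn', heq⟩ := hn
      have h1 : n' = n := Subtype.ext heq
      exact h1 ▸ hn'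
  · exact LinearMap.congr_fun h (⟨m, hm⟩ : N)

/-- Induction on the number of factors. Take an irreducible subrepresentation `τ` for the first
algebra; the others act on the multiplicity space $\operatorname{Hom}_{L_0}(\tau,V)$, and evaluating
its elements on `τ` uncurries the map obtained there. `V` need not be irreducible, since only a
nonzero equivariant map is wanted. -/
theorem exists_irreducible_multilinear {n : ℕ} {L : Fin n → Type w} [∀ i, LieRing (L i)]
    [∀ i, LieAlgebra k (L i)] {V : Type u} [AddCommGroup V] [Module k V] [FiniteDimensional k V]
    [Nontrivial V] (ρ : ∀ i, L i →ₗ[k] Module.End k V)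
    (hρ : ∀ i x y, ρ i ⁅x, y⁆ = ρ i x * ρ i y - ρ i y * ρ i x)
    (hcomm : ∀ i j, i ≠ j → ∀ x y, Commute (ρ i x) (ρ j y)) :
    ∃ (σ : ∀ i, LieFDRep.{u, w, u} k (L i)) (f : MultilinearMap k (fun i => (σ i).carrier) V),
      (∀ i, (σ i).IsIrreducible) ∧ f ≠ 0 ∧
        ∀ i (x : L i) m, f (Function.update m i ⁅x, m i⁆) = ρ i x (f m) := by
  induction n generalizing V with
  | zero =>
    obtain ⟨v, hv⟩ := exists_ne (0 : V)
    refine ⟨fun i => i.elim0, MultilinearMap.constOfIsEmpty k _ v, fun i => i.elim0, fun h => hv ?_,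
      fun i => i.elim0⟩
    exact congrArg (fun g : MultilinearMap k _ V => g fun i => i.elim0) h
  | succ n ih =>
    have : Nontrivial (ofLinear V (ρ 0) (hρ 0)).carrier := ‹Nontrivial V›
    obtain ⟨τ, f₀, hτ, hf₀, hf₀'⟩ := exists_irreducible_sub (ofLinear V (ρ 0) (hρ 0))
    change τ.carrier →ₗ[k] V at f₀
    -- The multiplicity space of `τ`. It contains the inclusion `f₀`, so it is nonzero, and the
    -- commuting actions preserve it by postcomposition.
    let W : Submodule k (τ.carrier →ₗ[k] V) :=
      { carrier := {g | ∀ (x : L 0) m, g ⁅x, m⁆ = ρ 0 x (g m)}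
        add_mem' := fun {g h} hg hh x m => by simp [hg x m, hh x m]
        zero_mem' := fun x m => by simp
        smul_mem' := fun c g hg x m => by simp [hg x m] }
    have hW : ∀ (i : Fin n) (x : L i.succ), ∀ g ∈ W,
        LinearMap.compRight k (ρ i.succ x) g ∈ W := by
      intro i x g hg y m
      have h1 : ρ i.succ x * ρ 0 y = ρ 0 y * ρ i.succ x := hcomm _ _ (Fin.succ_ne_zero i) x y
      change ρ i.succ x (g ⁅y, m⁆) = ρ 0 y (ρ i.succ x (g m))
      rw [hg y m]
      exact LinearMap.congr_fun h1 (g m)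
    let ρ' : ∀ i : Fin n, L i.succ →ₗ[k] Module.End k W := fun i =>
      { toFun := fun x => (LinearMap.compRight k (ρ i.succ x)).restrict (hW i x)
        map_add' := fun x y => by ext; simp
        map_smul' := fun c x => by ext; simp }
    have hρ'_apply : ∀ i x (g : W) m, (ρ' i x g).1 m = ρ i.succ x (g.1 m) := fun _ _ _ _ => rfl
    have : Nontrivial W := ⟨⟨f₀, hf₀'⟩, 0, fun h => hf₀ (congrArg Subtype.val h)⟩
    obtain ⟨σ, f, hσ, hf, hf'⟩ := ih (V := W) ρ'
      (fun i x y => by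
        refine LinearMap.ext fun g => Subtype.ext (LinearMap.ext fun m => ?_)
        rw [hρ'_apply, hρ]
        rfl)
      (fun i j hij x y => by
        refine LinearMap.ext fun g => Subtype.ext (LinearMap.ext fun m => ?_)
        exact LinearMap.congr_fun (hcomm i.succ j.succ
          (fun h => hij (Fin.succ_injective n h)) x y) (g.1 m))
    let σ' : ∀ i : Fin (n + 1), LieFDRep.{u, w, u} k (L i) :=
      Fin.cases (motive := fun i => LieFDRep.{u, w, u} k (L i)) τ σ
    let F : (σ' 0).carrier →ₗ[k] MultilinearMap k (fun i : Fin n => (σ' i.succ).carrier) V :=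
      { toFun := fun v => ((LinearMap.applyₗ v : (τ.carrier →ₗ[k] V) →ₗ[k] V) ∘ₗ
          W.subtype).compMultilinearMap f
        map_add' := fun v v' => MultilinearMap.ext fun m => map_add (f m).1 v v'
        map_smul' := fun c v => MultilinearMap.ext fun m => map_smul (f m).1 c v }
    have hF : ∀ v m, F v m = (f m).1 v := fun _ _ => rfl
    refine ⟨σ', F.uncurryLeft, ?_, ?_, ?_⟩
    · exact Fin.cases hτ hσ
    · intro h0
      apply hf
      ext m v
      have h1 := congrArg (fun g : MultilinearMap k (fun i => (σ' i).carrier) V =>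
        g (Fin.cons (α := fun i => (σ' i).carrier) v m)) h0
      exact h1
    · intro i
      refine Fin.cases ?_ (fun i => ?_) i
      · intro x m
        rw [LinearMap.uncurryLeft_apply, LinearMap.uncurryLeft_apply, hF, hF, Function.update_self,
          Fin.tail_update_zero]
        exact (f (Fin.tail m)).2 x (m 0)
      · intro x m
        rw [LinearMap.uncurryLeft_apply, LinearMap.uncurryLeft_apply, hF, hF,
          Fin.tail_update_succ, Function.update_of_ne (Fin.succ_ne_zero i).symm]
        exact congrArg (fun g : W => g.1 (m 0)) (hf' i x (Fin.tail m))

end LieFDRep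

/-! ### Separation of rational points -/

namespace RatPoint

variable {k : Type u} {A : Type v} [Field k] [CommRing A] [Algebra k A]

/-- For each `y` in `T` some `g` has different values at `x` and `y`; normalise it to
$(g-g(y))/(g(x)-g(y))$ and multiply over `T`. -/
theorem exists_eq_one_of_notMem (x : RatPoint k A) (T : Finset (RatPoint k A)) (hx : x ∉ T) :
    ∃ f : A, x f = 1 ∧ ∀ y ∈ T, y f = 0 := by
  have h : ∀ y : RatPoint k A, ∃ f : A, y ∈ T → x f = 1 ∧ y f = 0 := by
    intro y
    by_cases hy : y ∈ T
    · obtain ⟨g, hg⟩ : ∃ g, x g ≠ y g := by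
        by_contra! h
        exact hx ((AlgHom.ext h : x = y) ▸ hy)
      refine ⟨algebraMap k A (x g - y g)⁻¹ * (g - algebraMap k A (y g)), fun _ => ⟨?_, ?_⟩⟩
      · rw [map_mul, map_sub, AlgHom.commutes, AlgHom.commutes]
        exact inv_mul_cancel₀ (sub_ne_zero.2 hg)
      · rw [map_mul, map_sub, AlgHom.commutes, AlgHom.commutes]
        simp
    · exact ⟨0, fun h => absurd h hy⟩
  choose f hf using h
  refine ⟨∏ y ∈ T, f y, ?_, fun y hy => ?_⟩
  · rw [map_prod]
    exact Finset.prod_eq_one fun y hy => (hf y hy).1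
  · rw [map_prod]
    exact Finset.prod_eq_zero hy (hf y hy).2

end RatPoint

/-! ### Averaging over the group, and evaluation at points in distinct orbits -/

namespace EquivariantPair

variable {k : Type u} {A : Type v} {𝔤 : Type w} {Γ : Type w'}
  [Field k] [CommRing A] [Algebra k A] [LieRing 𝔤] [LieAlgebra k 𝔤] [Group Γ]
  (D : EquivariantPair k A 𝔤 Γ)

theorem onTensor_tmul (γ : Γ) (f : A) (u : 𝔤) :
    D.onTensor γ (f ⊗ₜ[k] u) = D.onAlg γ f ⊗ₜ[k] D.onLie γ u := rfl

theorem onTensor_mul (γ δ : Γ) (z : A ⊗[k] 𝔤) :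
    D.onTensor (γ * δ) z = D.onTensor γ (D.onTensor δ z) := by
  induction z with
  | zero => simp
  | tmul f u => simp [onTensor_tmul]
  | add a b ha hb => simp only [map_add, ha, hb]

theorem onTensor_smul (γ : Γ) (a : A) (z : A ⊗[k] 𝔤) :
    D.onTensor γ (a • z) = D.onAlg γ a • D.onTensor γ z := by
  induction z with
  | zero => simp
  | tmul f u => simp [onTensor_tmul, TensorProduct.smul_tmul']
  | add a b ha hb => simp only [map_add, smul_add, ha, hb]

theorem evalTensor_smul (x : RatPoint k A) (a : A) (z : A ⊗[k] 𝔤) :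
    evalTensor x (a • z) = x a • evalTensor x z := by
  induction z with
  | zero => simp
  | tmul f u => simp [evalTensor_tmul, TensorProduct.smul_tmul', smul_smul]
  | add a b ha hb => simp only [map_add, smul_add, ha, hb]

/-- The sum over `Γ` of the translates of an element of `A ⊗ 𝔤`. -/
def orbitSum [Fintype Γ] : A ⊗[k] 𝔤 →ₗ[k] A ⊗[k] 𝔤 :=
  ∑ γ, (D.onTensor γ : A ⊗[k] 𝔤 →ₗ[k] A ⊗[k] 𝔤)

theorem orbitSum_apply [Fintype Γ] (z : A ⊗[k] 𝔤) : D.orbitSum z = ∑ γ, D.onTensor γ z := by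
  simp [orbitSum]

theorem orbitSum_mem [Fintype Γ] (z : A ⊗[k] 𝔤) : D.orbitSum z ∈ D.mapAlgebra := by
  intro γ
  rw [orbitSum_apply, map_sum]
  simp_rw [← D.onTensor_mul]
  exact Fintype.sum_equiv (Equiv.mulLeft γ) _ _ fun _ => rfl

/-- Fixed elements are recovered from the unnormalised sum up to the factor $|\Gamma|$, invertible
in characteristic zero. -/
theorem orbitSum_of_mem [Fintype Γ] {α : A ⊗[k] 𝔤} (h : α ∈ D.mapAlgebra) :
    D.orbitSum α = (Fintype.card Γ : k) • α := by
  rw [orbitSum_apply, Finset.sum_congr rfl fun γ _ => h γ]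
  simp [Nat.cast_smul_eq_nsmul]

theorem coe_ev (x : RatPoint k A) (α : D.mapAlgebra) : (D.ev x α : 𝔤) = evalTensor x α.1 := rfl

theorem actPoint_apply (γ : Γ) (x : RatPoint k A) (f : A) :
    D.actPoint γ x f = x (D.onAlg γ⁻¹ f) := rfl

theorem actPoint_inv_eq_iff (γ : Γ) (x y : RatPoint k A) :
    D.actPoint γ⁻¹ x = y ↔ D.actPoint γ y = x := by
  constructor
  · rintro rfl
    rw [← actPoint_mul, mul_inv_cancel, actPoint_one]
  · rintro rfl
    rw [← actPoint_mul, inv_mul_cancel, actPoint_one]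

/-- The points of the family `x` lie in pairwise distinct `Γ`-orbits. -/
def DistinctOrbits {ι : Type*} (x : ι → RatPoint k A) : Prop :=
  ∀ i j, (∃ γ : Γ, D.actPoint γ (x i) = x j) → i = j

variable {D}

/-- Evaluation is onto $\prod_i\mathfrak g^{x_i}$: average $f_i\otimes u$ with $f_i$ equal to $1$ at
$x_i$ and $0$ at all other points of the given orbits. At $x_i$ only the stabilizer contributes, and
each of its elements fixes $u$. The sections are linear, not homomorphisms; the defect is killed by
all evaluations. -/
theorem exists_ev_section [CharZero k] [Finite Γ] {n : ℕ} {x : Fin n → RatPoint k A}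
    (hx : D.DistinctOrbits x) :
    ∃ s : ∀ i, D.isotropy (x i) →ₗ[k] D.mapAlgebra,
      (∀ i u, D.ev (x i) (s i u) = u) ∧ ∀ i j, i ≠ j → ∀ u, D.ev (x j) (s i u) = 0 := by
  classical
  cases nonempty_fintype Γ
  have hf : ∀ i, ∃ f : A, x i f = 1 ∧ ∀ j (γ : Γ), D.actPoint γ (x j) ≠ x i →
      D.actPoint γ (x j) f = 0 := by
    intro i
    obtain ⟨f, hf, hf'⟩ := RatPoint.exists_eq_one_of_notMem (x i)
      ((Finset.univ.image fun p : Fin n × Γ => D.actPoint p.2 (x p.1)).erase (x i))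
      (Finset.notMem_erase _ _)
    exact ⟨f, hf, fun j γ h => hf' _ (Finset.mem_erase.2
      ⟨h, Finset.mem_image.2 ⟨(j, γ), Finset.mem_univ _, rfl⟩⟩)⟩
  choose f hf hf' using hf
  -- The order of the stabilizer is the normalising constant: that many equal terms survive at `x
  -- i`.
  let stab := fun i => Finset.univ.filter fun γ : Γ => D.actPoint γ (x i) = x i
  have hcard : ∀ i, ((stab i).card : k) ≠ 0 := fun i => Nat.cast_ne_zero.2
    (Finset.card_ne_zero.2 ⟨1, Finset.mem_filter.2 ⟨Finset.mem_univ _, D.actPoint_one _⟩⟩)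
  let s : ∀ i, D.isotropy (x i) →ₗ[k] D.mapAlgebra := fun i =>
    LinearMap.codRestrict D.mapAlgebra.toSubmodule
      (((stab i).card : k)⁻¹ • (D.orbitSum ∘ₗ TensorProduct.mk k A 𝔤 (f i) ∘ₗ
        (D.isotropy (x i)).toSubmodule.subtype))
      fun u => D.mapAlgebra.smul_mem _ (D.orbitSum_mem _)
  have hs : ∀ i j u, (D.ev (x j) (s i u) : 𝔤) =
      ((stab i).card : k)⁻¹ • ∑ γ : Γ, D.actPoint γ⁻¹ (x j) (f i) • D.onLie γ u.1 := by
    intro i j u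
    have h1 : (s i u).1 = ((stab i).card : k)⁻¹ • D.orbitSum (f i ⊗ₜ[k] u.1) := rfl
    rw [coe_ev, h1, map_smul, orbitSum_apply, map_sum]
    congr 1
    refine Finset.sum_congr rfl fun γ _ => ?_
    rw [onTensor_tmul, evalTensor_tmul, actPoint_apply, inv_inv]
  refine ⟨s, fun i u => Subtype.ext ?_, fun i j hij u => Subtype.ext ?_⟩
  · rw [hs, inv_smul_eq_iff₀ (hcard i), Nat.cast_smul_eq_nsmul, ← Finset.sum_const,
      Finset.sum_filter]
    refine Finset.sum_congr rfl fun γ _ => ?_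
    split_ifs with h
    · rw [(D.actPoint_inv_eq_iff γ _ _).2 h, hf, one_smul]
      exact u.2 γ h
    · rw [hf' i i _ fun h' => h ((D.actPoint_inv_eq_iff γ _ _).1 h'), zero_smul]
  · rw [hs, Finset.sum_eq_zero, smul_zero]
    · rfl
    · intro γ _
      rw [hf' i j _ fun h' => hij (hx j i ⟨_, h'⟩).symm, zero_smul]

variable {n : ℕ} {x : Fin n → RatPoint k A} {ρ : ∀ i, LieFDRep.{u, w, u} k (D.isotropy (x i))}

theorem evRep_lie (α : D.mapAlgebra) (z : ⨂[k] i, (ρ i).carrier) :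
    (⁅α, (z : (D.evRep x ρ).carrier)⁆ : (D.evRep x ρ).carrier) =
      ∑ i, PiTensorProduct.mapMonoidHom
        (Pi.mulSingle i (LieModule.toEnd k _ (ρ i).carrier (D.ev (x i) α))) z := by
  exact (LinearMap.congr_fun
    (LieFDRep.piTensorAux_apply (fun i => (ρ i).comap (D.ev (x i))) α) z).trans
    (LinearMap.sum_apply Finset.univ (fun i => PiTensorProduct.mapMonoidHom
      (Pi.mulSingle i (LieModule.toEnd k _ (ρ i).carrier (D.ev (x i) α)))) z)

/-- Isolates one tensor slot; the sections `s i` provide such `α` with any prescribed value. -/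
theorem evRep_lie_eq_single (α : D.mapAlgebra) (i : Fin n)
    (h : ∀ j, j ≠ i → D.ev (x j) α = 0) (z : ⨂[k] i, (ρ i).carrier) :
    (⁅α, (z : (D.evRep x ρ).carrier)⁆ : (D.evRep x ρ).carrier) =
      PiTensorProduct.mapMonoidHom
        (Pi.mulSingle i (LieModule.toEnd k _ (ρ i).carrier (D.ev (x i) α))) z := by
  rw [evRep_lie]
  refine Finset.sum_eq_single i (fun j _ hj => ?_) (by simp)
  rw [h j hj, map_zero, PiTensorProduct.mapMonoidHom_mulSingle_zero, LinearMap.zero_apply]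
  rfl

/-- The element `s i u` acts by `u` in slot `i` and trivially elsewhere, so an invariant subspace is
stable under each factor separately. -/
theorem isIrreducible_evRep [IsAlgClosed k] [CharZero k] [Finite Γ] (hx : D.DistinctOrbits x)
    (hρ : ∀ i, (ρ i).IsIrreducible) : (D.evRep x ρ).IsIrreducible := by
  obtain ⟨s, hs, hs'⟩ := exists_ev_section hx
  have hn : ∀ i, Nontrivial (ρ i).carrier := fun i => ((LieFDRep.isIrreducible_iff _).1 (hρ i)).1
  refine (LieFDRep.isIrreducible_iff _).2 ⟨?_, fun W hW => ?_⟩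
  · let b := fun i => Module.finBasis k (ρ i).carrier
    let B := Basis.piTensorProduct b
    have : Nonempty (∀ i, Fin (Module.finrank k (ρ i).carrier)) :=
      ⟨fun i => ⟨0, Module.finrank_pos⟩⟩
    exact B.repr.toEquiv.nontrivial
  · refine PiTensorProduct.eq_bot_or_eq_top_of_irreducible
      (fun i => Set.range fun u => LieModule.toEnd k (D.isotropy (x i)) (ρ i).carrier u)
      (fun i U hU => ((LieFDRep.isIrreducible_iff _).1 (hρ i)).2 U
        fun u m hm => hU _ ⟨u, rfl⟩ m hm) W ?_
    rintro i _ ⟨u, rfl⟩ z hz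
    have h := hW (s i u) z hz
    rw [evRep_lie_eq_single (s i u) i fun j hj => hs' i j hj.symm u, hs] at h
    exact h

/-- An irreducible representation receiving a nonzero equivariant multilinear map from
irreducible representations at points in distinct orbits is the evaluation representation. -/
theorem evRep_iso_of_multilinear [IsAlgClosed k] [CharZero k] [Finite Γ]
    (hx : D.DistinctOrbits x) (hρ : ∀ i, (ρ i).IsIrreducible)
    {σ : LieFDRep.{u, max v w, w₁} k D.mapAlgebra} (hσ : σ.IsIrreducible)
    (f : MultilinearMap k (fun i => (ρ i).carrier) σ.carrier) (hf : f ≠ 0)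
    (h : ∀ (α : D.mapAlgebra) m, ⁅α, f m⁆ = ∑ i, f (Function.update m i ⁅D.ev (x i) α, m i⁆)) :
    (D.evRep x ρ).Iso σ := by
  let F : (⨂[k] i, (ρ i).carrier) →ₗ[k] σ.carrier := PiTensorProduct.lift f
  have hF : ∀ (α : D.mapAlgebra) z, F (∑ i, PiTensorProduct.mapMonoidHom
      (Pi.mulSingle i (LieModule.toEnd k _ (ρ i).carrier (D.ev (x i) α))) z) = ⁅α, F z⁆ := by
    intro α z
    induction z using PiTensorProduct.induction_on with
    | smul_tprod r m =>
      simp only [map_smul, PiTensorProduct.mapMonoidHom_mulSingle_tprod, ← Finset.smul_sum,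
        map_sum, F, PiTensorProduct.lift.tprod, lie_smul, h]
      rfl
    | add a b ha hb => simp only [map_add, Finset.sum_add_distrib, ha, hb, lie_add]
  refine (isIrreducible_evRep hx hρ).iso_of_ne_zero hσ F
    (fun α z => (congrArg F (evRep_lie α z)).trans (hF α z)) fun h0 => hf ?_
  · exact MultilinearMap.ext fun m => by
      rw [← PiTensorProduct.lift.tprod (φ := f)]
      exact LinearMap.congr_fun h0 _

/-- A scalar in one slot is the same scalar on the whole tensor product, so the identity map
intertwines the two actions. -/
theorem twist_evRep_iso (φ : ∀ i, AbDual k (D.isotropy (x i))) (mu : AbDual k D.mapAlgebra)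
    (hmu : ∀ α, mu.eval α = ∑ i, (φ i).eval (D.ev (x i) α)) :
    (LieFDRep.twist mu (D.evRep x ρ)).Iso (D.evRep x fun i => LieFDRep.twist (φ i) (ρ i)) := by
  refine LieFDRep.Iso.of_linearEquiv (ρ := LieFDRep.twist mu (D.evRep x ρ))
    (σ := D.evRep x fun i => LieFDRep.twist (φ i) (ρ i))
    (LinearEquiv.refl k (⨂[k] i, (ρ i).carrier)) fun α z => ?_
  change ⨂[k] i, (ρ i).carrier at z
  have h1 := evRep_lie (ρ := ρ) α z
  have h2 := evRep_lie (ρ := fun i => LieFDRep.twist (φ i) (ρ i)) α z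
  refine Eq.trans (b := (∑ i, PiTensorProduct.mapMonoidHom (R := k) (s := fun i => (ρ i).carrier)
        (Pi.mulSingle i (LieModule.toEnd k _ (ρ i).carrier (D.ev (x i) α))) z) +
          mu.eval α • z) ?_ (Eq.trans ?_ h2.symm)
  · exact congrArg (· + mu.eval α • z) h1
  · rw [hmu, Finset.sum_smul, ← Finset.sum_add_distrib]
    refine Finset.sum_congr rfl fun i _ => ?_
    have h3 : PiTensorProduct.mapMonoidHom (R := k) (s := fun i => (ρ i).carrier)
        (Pi.mulSingle i (LieModule.toEnd k _ (ρ i).carrier (D.ev (x i) α) +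
          (φ i).eval (D.ev (x i) α) • 1)) z =
      PiTensorProduct.mapMonoidHom (R := k) (s := fun i => (ρ i).carrier)
        (Pi.mulSingle i (LieModule.toEnd k _ (ρ i).carrier (D.ev (x i) α))) z +
        (φ i).eval (D.ev (x i) α) • z := by
      rw [PiTensorProduct.mapMonoidHom_mulSingle_add,
        PiTensorProduct.mapMonoidHom_mulSingle_smul_one]
      rfl
    exact h3.symm

/-- Multiplication $k^n\to k$ is a nonzero equivariant multilinear map. -/
theorem evRep_oneDim_iso [IsAlgClosed k] [CharZero k] [Finite Γ] (hx : D.DistinctOrbits x)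
    (φ : ∀ i, AbDual k (D.isotropy (x i))) (mu : AbDual k D.mapAlgebra)
    (hmu : ∀ α, mu.eval α = ∑ i, (φ i).eval (D.ev (x i) α)) :
    (D.evRep x fun i => LieFDRep.oneDim (φ i)).Iso (LieFDRep.oneDim mu) := by
  let f : MultilinearMap k (fun _ : Fin n => k) k := MultilinearMap.mkPiAlgebra k (Fin n) k
  refine evRep_iso_of_multilinear hx
    (fun i => LieFDRep.isIrreducible_of_dim_eq_one (LieFDRep.dim_oneDim _))
    (LieFDRep.isIrreducible_of_dim_eq_one (LieFDRep.dim_oneDim mu)) f (fun h => ?_) fun α m => ?_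
  · have h1 := congrArg (fun g : MultilinearMap k (fun _ : Fin n => k) k => g fun _ => 1) h
    have h2 : (∏ _i : Fin n, (1 : k)) = 0 := h1
    simp at h2
  · change Fin n → k at m
    change mu.eval α * f m = ∑ i, f (Function.update m i ((φ i).eval (D.ev (x i) α) • m i))
    simp_rw [f.map_update_smul, Function.update_eq_self, smul_eq_mul]
    rw [hmu, Finset.sum_mul]

/-- A trivial factor acts by zero and can be absorbed into a scalar: $(a,m)\mapsto c(a)\,\bigotimes
m_j$ is equivariant. -/
theorem evRep_iso_tail [IsAlgClosed k] [CharZero k] [Finite Γ] {x : Fin (n + 1) → RatPoint k A}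
    {ρ : ∀ i, LieFDRep.{u, w, u} k (D.isotropy (x i))} (hx : D.DistinctOrbits x)
    (hρ : ∀ i, (ρ i).IsIrreducible) (htriv : (ρ 0).Iso (LieFDRep.oneDim 0)) :
    (D.evRep x ρ).Iso (D.evRep (fun j : Fin n => x j.succ) (fun j => ρ j.succ)) := by
  obtain ⟨c, hc⟩ := htriv.exists_linearEquiv
  change (ρ 0).carrier ≃ₗ[k] k at c
  have hlie : ∀ (u : D.isotropy (x 0)) (m : (ρ 0).carrier), ⁅u, m⁆ = 0 := fun u m =>
    c.injective (((hc u m).trans (zero_mul (M₀ := k) (c m))).trans (map_zero c).symm)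
  let σ : ∀ j : Fin n, LieFDRep.{u, w, u} k (D.isotropy (x j.succ)) := fun j => ρ j.succ
  let T : LieFDRep.{u, max v w, u} k D.mapAlgebra := D.evRep (fun j : Fin n => x j.succ) σ
  have hT : T.IsIrreducible := isIrreducible_evRep
    (fun a b h => Fin.succ_injective n (hx _ _ h)) fun j => hρ _
  let tp : MultilinearMap k (fun j => (σ j).carrier) (⨂[k] j, (σ j).carrier) :=
    PiTensorProduct.tprod k
  -- The same map, with its codomain seen as the representation space of `T` so that the bracket is
  -- available.
  let tp : MultilinearMap k (fun j => (σ j).carrier) T.carrier := tp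
  have htp : ∀ (α : D.mapAlgebra) m, ⁅α, tp m⁆ =
      ∑ j, tp (Function.update m j ⁅D.ev (x j.succ) α, m j⁆) := fun α m =>
    LieFDRep.piTensorAux_tprod (fun j : Fin n => (σ j).comap (D.ev (x j.succ))) α m
  let F : (ρ 0).carrier →ₗ[k] MultilinearMap k (fun j => (σ j).carrier) T.carrier :=
    (c : (ρ 0).carrier →ₗ[k] k).smulRight tp
  have hF : ∀ a m, F a m = c a • tp m := fun _ _ => rfl
  let G : MultilinearMap k (fun i => (ρ i).carrier) T.carrier :=
    LinearMap.uncurryLeft (M := fun i => (ρ i).carrier) F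
  refine evRep_iso_of_multilinear hx hρ hT G (fun h0 => ?_) fun α m => ?_
  · obtain ⟨m, hm⟩ : ∃ m, tp m ≠ 0 := by
      by_contra! h
      have h4 : (LinearMap.id : (⨂[k] j, (σ j).carrier) →ₗ[k] _) = 0 :=
        PiTensorProduct.ext (MultilinearMap.ext fun m => h m)
      have : Nontrivial T.carrier := ((LieFDRep.isIrreducible_iff T).1 hT).1
      obtain ⟨z, hz⟩ := exists_ne (0 : T.carrier)
      exact hz (LinearMap.congr_fun h4 z)
    have h5 := congrArg (fun g : MultilinearMap k (fun j => (ρ j).carrier) T.carrier =>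
      g (Fin.cons (α := fun j => (ρ j).carrier) (c.symm 1) m)) h0
    have h6 : c (c.symm 1) • tp m = 0 := h5
    rw [LinearEquiv.apply_symm_apply, one_smul] at h6
    exact hm h6
  · have h7 : ∀ m : ∀ i, (ρ i).carrier,
        G m = c (m 0) • tp (fun j => m j.succ) := fun _ => rfl
    rw [Fin.sum_univ_succ, h7, h7, Function.update_self, hlie, map_zero, zero_smul, zero_add,
      lie_smul, htp, Finset.smul_sum]
    refine Finset.sum_congr rfl fun j _ => ?_
    rw [h7, Function.update_of_ne (Fin.succ_ne_zero j).symm]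
    congr 2
    funext l
    by_cases hl : l = j
    · subst hl; simp
    · rw [Function.update_of_ne hl, Function.update_of_ne fun h => hl (Fin.succ_injective n h)]

namespace ClassFun

/-- `ev_Ψ` may be computed from representatives of any finite set of orbits that contains the
support of `Ψ`. -/
theorem evClass_eq_of_cover [IsAlgClosed k] [CharZero k] [Finite Γ] {Ψ : D.ClassFun}
    (hΨ : Ψ ∈ D.irredFun) (hx : D.DistinctOrbits x)
    (hcover : ∀ y, Ψ.toFun y ≠ LieRepClass.trivial → ∃ i, ∃ γ : Γ, D.actPoint γ (x i) = y)
    (hρ : ∀ i, LieRepClass.mk (ρ i) = Ψ.toFun (x i)) :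
    Ψ.evClass = LieRepClass.mk (D.evRep x ρ) := by
  induction n with
  | zero =>
    exact Ψ.evClass_eq ⟨fun i => i.elim0, fun y hy => (hcover y hy).elim fun i => i.elim0⟩ ρ hρ
  | succ n ih =>
    by_cases hne : ∀ i, Ψ.toFun (x i) ≠ LieRepClass.trivial
    · refine Ψ.evClass_eq ⟨hne, fun y hy => ?_⟩ ρ hρ
      obtain ⟨i, γ, rfl⟩ := hcover y hy
      refine ⟨i, ⟨γ, rfl⟩, ?_⟩
      rintro j ⟨δ, hδ⟩
      refine hx j i ⟨γ⁻¹ * δ, ?_⟩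
      rw [D.actPoint_mul, hδ, ← D.actPoint_mul, inv_mul_cancel, D.actPoint_one]
    -- A point with trivial value is swapped into position `0` and removed; the induction is on the
    -- number of points.
    push Not at hne
    obtain ⟨i, hi⟩ := hne
    let e : Fin (n + 1) ≃ Fin (n + 1) := Equiv.swap 0 i
    have he : e.symm 0 = i := by simp [e]
    let x' := fun j => x (e.symm j)
    let ρ' := fun j => ρ (e.symm j)
    have hx' : D.DistinctOrbits x' := fun a b h => e.symm.injective (hx _ _ h)
    have hρ' : ∀ j, (ρ' j).IsIrreducible := fun j => by
      rw [← LieRepClass.isIrreducible_mk, hρ]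
      exact hΨ _
    have h1 : (D.evRep x ρ).Iso (D.evRep x' ρ') :=
      LieFDRep.Iso.piTensor e fun j => LieFDRep.Iso.refl _
    have htriv : (ρ' 0).Iso (LieFDRep.oneDim 0) := LieRepClass.mk_eq_mk.1 <| by
      have h3 : LieRepClass.mk (ρ (e.symm 0)) = LieRepClass.trivial := by rw [he, hρ, hi]
      exact h3
    have h2 := evRep_iso_tail hx' hρ' htriv
    rw [LieRepClass.mk_eq_mk.2 (h1.trans h2)]
    refine ih
      (x := fun j : Fin n => x' j.succ) (ρ := fun j => ρ' j.succ)
      (fun a b h => Fin.succ_injective n (hx' _ _ h)) ?_ fun j => hρ (e.symm j.succ)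
    intro y hy
    obtain ⟨j, γ, rfl⟩ := hcover y hy
    -- Equivariance makes the values on the whole removed orbit trivial, so no point of the support
    -- is lost.
    have hj : e j ≠ 0 := by
      rintro h
      have : j = i := by rw [← he, ← h, Equiv.symm_apply_apply]
      subst this
      apply hy
      rw [Ψ.equivariant, hi, LieRepClass.comap_trivial]
    obtain ⟨l, hl⟩ := Fin.exists_succ_eq.2 hj
    refine ⟨l, γ, ?_⟩
    have : x' l.succ = x j := by simp [x', hl]
    rw [this]

end ClassFun

end EquivariantPair

/-! ### Invariants and traceless irreducible representations -/

namespace EquivariantPair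

variable {k : Type u} {A : Type v} {𝔤 : Type w} {Γ : Type w'}
  [Field k] [CommRing A] [Algebra k A] [LieRing 𝔤] [LieAlgebra k 𝔤] [Group Γ]
  (D : EquivariantPair k A 𝔤 Γ)

/-- The algebra `A^Γ` of invariants. -/
def invariants : Subalgebra k A where
  carrier := {a | ∀ γ, D.onAlg γ a = a}
  mul_mem' := fun ha hb γ => by rw [map_mul, ha γ, hb γ]
  add_mem' := fun ha hb γ => by rw [map_add, ha γ, hb γ]
  algebraMap_mem' := fun c γ => AlgEquiv.commutes _ c

theorem isIntegral_invariants [Finite Γ] : Algebra.IsIntegral D.invariants A := by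
  let _ : MulSemiringAction Γ A :=
    { smul := fun γ a => D.onAlg γ a
      one_smul := fun a => by change D.onAlg 1 a = a; simp
      mul_smul := fun γ δ a => by change D.onAlg (γ * δ) a = D.onAlg γ (D.onAlg δ a); simp
      smul_zero := fun γ => map_zero (D.onAlg γ)
      smul_add := fun γ => map_add (D.onAlg γ)
      smul_one := fun γ => map_one (D.onAlg γ)
      smul_mul := fun γ => map_mul (D.onAlg γ) }
  have : Algebra.IsInvariant D.invariants A Γ := ⟨fun a h => ⟨⟨a, h⟩, rfl⟩⟩
  exact Algebra.IsInvariant.isIntegral D.invariants A Γ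

theorem actPoint_apply_of_mem (γ : Γ) (x : RatPoint k A) {a : A} (ha : a ∈ D.invariants) :
    D.actPoint γ x a = x a := by
  rw [actPoint_apply, ha]

/-- Invariants separate orbits: if `y` is not in the orbit of `x`, take `f` equal to $1$ at `x` and
$0$ at the other points of both orbits. Its sum over the group is $|\Gamma_x|\ne0$ at `x` and $0$ at
`y`. -/
theorem exists_actPoint_eq [CharZero k] [Finite Γ] {x y : RatPoint k A}
    (h : ∀ a ∈ D.invariants, x a = y a) : ∃ γ : Γ, D.actPoint γ x = y := by
  classical
  cases nonempty_fintype Γ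
  by_contra! hne
  obtain ⟨f, hf, hf'⟩ := RatPoint.exists_eq_one_of_notMem x
    (((Finset.univ.image fun γ : Γ => D.actPoint γ x) ∪
      Finset.univ.image fun γ : Γ => D.actPoint γ y).erase x) (Finset.notMem_erase _ _)
  have hfx : ∀ γ : Γ, D.actPoint γ x ≠ x → D.actPoint γ x f = 0 := fun γ hγ =>
    hf' _ (Finset.mem_erase.2 ⟨hγ, Finset.mem_union_left _
      (Finset.mem_image_of_mem _ (Finset.mem_univ _))⟩)
  have hfy : ∀ γ : Γ, D.actPoint γ y f = 0 := fun γ =>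
    hf' _ (Finset.mem_erase.2 ⟨fun hγ => hne γ⁻¹ ((D.actPoint_inv_eq_iff γ x y).2 hγ),
      Finset.mem_union_right _ (Finset.mem_image_of_mem _ (Finset.mem_univ _))⟩)
  have hsum : ∀ z : RatPoint k A, z (∑ γ : Γ, D.onAlg γ⁻¹ f) = ∑ γ : Γ, D.actPoint γ z f :=
    fun z => map_sum z _ _
  have hmem : (∑ γ : Γ, D.onAlg γ⁻¹ f) ∈ D.invariants := by
    intro δ
    rw [map_sum]
    refine Fintype.sum_equiv (Equiv.mulRight δ⁻¹) _ _ fun γ => ?_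
    simp
  have h1 := h _ hmem
  rw [hsum, hsum, Finset.sum_eq_zero (s := Finset.univ) fun γ _ => hfy γ] at h1
  have h2 : ∑ γ : Γ, D.actPoint γ x f =
      ((Finset.univ.filter fun γ : Γ => D.actPoint γ x = x).card : k) := by
    rw [Finset.card_eq_sum_ones, Nat.cast_sum, Finset.sum_filter]
    refine Finset.sum_congr rfl fun γ _ => ?_
    split_ifs with hγ
    · rw [hγ, hf, Nat.cast_one]
    · exact hfx γ hγ
  rw [h2, Nat.cast_eq_zero, Finset.card_eq_zero] at h1
  exact Finset.notMem_empty (1 : Γ)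
    (h1 ▸ Finset.mem_filter.2 ⟨Finset.mem_univ _, D.actPoint_one x⟩)

/-- Points over `I` restrict to characters of the finite-dimensional algebra $A^\Gamma/I$, of which
there are finitely many, and two points have the same restriction exactly when they share an orbit.
Choose one point per character that occurs. -/
theorem exists_points_of_finite_quotient [CharZero k] [Finite Γ] (I : Ideal D.invariants)
    [FiniteDimensional k (D.invariants ⧸ I)] :
    ∃ (n : ℕ) (x : Fin n → RatPoint k A), D.DistinctOrbits x ∧
      ∀ y : RatPoint k A, (∀ a ∈ I, y a = 0) → ∃ i, ∃ γ : Γ, D.actPoint γ (x i) = y := by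
  let X := {y : RatPoint k A // ∀ a ∈ I, y a = 0}
  let res : X → (D.invariants ⧸ I →ₐ[k] k) := fun y =>
    Ideal.Quotient.liftₐ I (y.1.comp D.invariants.val) y.2
  have hres : ∀ (y : X) (a : D.invariants), res y (Ideal.Quotient.mk I a) = y.1 a :=
    fun _ _ => rfl
  obtain ⟨n, ⟨e⟩⟩ := Finite.exists_equiv_fin (Set.range res)
  choose x hx using fun t : Set.range res => t.2
  refine ⟨n, fun i => (x (e.symm i)).1, ?_, fun y hy => ⟨e ⟨res ⟨y, hy⟩, _, rfl⟩, ?_⟩⟩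
  · rintro i j ⟨γ, hγ⟩
    refine e.symm.injective (Subtype.ext ?_)
    rw [← hx, ← hx]
    refine AlgHom.ext fun a => ?_
    obtain ⟨a, rfl⟩ := Ideal.Quotient.mk_surjective a
    rw [hres, hres]
    exact (D.actPoint_apply_of_mem γ _ a.2).symm.trans (AlgHom.congr_fun hγ a.1)
  · refine D.exists_actPoint_eq fun a ha => ?_
    have h := hx (e.symm (e ⟨res ⟨y, hy⟩, _, rfl⟩))
    rw [e.symm_apply_apply] at h
    have h' := AlgHom.congr_fun h (Ideal.Quotient.mk I ⟨a, ha⟩)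
    rw [hres, hres] at h'
    simpa using h'

/-- A Nullstellensatz without finite generation of $A$: for a prime $P\supseteq IA$ the domain $A/P$
is integral over $A^\Gamma/I$, hence over $k$, hence equal to $k$. So $P$ is the kernel of a
rational point over $I$. -/
theorem mem_radical_of_forall_point [IsAlgClosed k] [Finite Γ] (I : Ideal D.invariants)
    [FiniteDimensional k (D.invariants ⧸ I)] {f : A}
    (hf : ∀ y : RatPoint k A, (∀ a ∈ I, y a = 0) → y f = 0) :
    f ∈ (I.map (algebraMap D.invariants A)).radical := by
  rw [Ideal.radical_eq_sInf, Ideal.mem_sInf]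
  rintro P ⟨hP, hPprime⟩
  have := D.isIntegral_invariants
  have hle : ∀ a ∈ I, ((Ideal.Quotient.mkₐ k P).comp D.invariants.val) a = 0 := fun a ha =>
    Ideal.Quotient.eq_zero_iff_mem.2 (hP (Ideal.mem_map_of_mem _ ha))
  let φ : D.invariants ⧸ I →ₐ[k] A ⧸ P :=
    Ideal.Quotient.liftₐ I ((Ideal.Quotient.mkₐ k P).comp D.invariants.val) hle
  have h1 : (φ.toRingHom.comp (Ideal.Quotient.mk I)).IsIntegral :=
    RingHom.IsIntegral.trans (algebraMap D.invariants A) (Ideal.Quotient.mk P)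
      Algebra.IsIntegral.isIntegral (RingHom.isIntegral_of_surjective _ Ideal.Quotient.mk_surjective)
  have h2 : φ.toRingHom.IsIntegral := RingHom.IsIntegral.tower_top _ _ h1
  have h3 : (φ.toRingHom.comp (algebraMap k (D.invariants ⧸ I))).IsIntegral :=
    RingHom.IsIntegral.trans _ _ (algebraMap_isIntegral_iff.2 (Algebra.IsIntegral.of_finite k _)) h2
  have h4 : Algebra.IsIntegral k (A ⧸ P) := by
    rw [← algebraMap_isIntegral_iff, ← φ.comp_algebraMap]
    exact h3
  let e : k ≃ₐ[k] A ⧸ P := AlgEquiv.ofBijective (Algebra.ofId k (A ⧸ P))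
    IsAlgClosed.algebraMap_bijective_of_isIntegral
  have h5 := hf ((e.symm : A ⧸ P →ₐ[k] k).comp (Ideal.Quotient.mkₐ k P)) fun a ha => by
    have h6 : Ideal.Quotient.mkₐ k P (a : A) = 0 := hle a ha
    rw [AlgHom.comp_apply, h6, map_zero]
  refine Ideal.Quotient.eq_zero_iff_mem.1 (e.symm.injective ?_)
  rw [map_zero]
  exact h5

theorem lie_mem_smul_top {J₁ J₂ : Ideal A} {z t : A ⊗[k] 𝔤}
    (hz : z ∈ J₁ • (⊤ : Submodule A (A ⊗[k] 𝔤))) (ht : t ∈ J₂ • (⊤ : Submodule A (A ⊗[k] 𝔤))) :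
    ⁅z, t⁆ ∈ (J₁ * J₂) • (⊤ : Submodule A (A ⊗[k] 𝔤)) := by
  induction hz using Submodule.smul_induction_on' with
  | smul a ha z _ =>
    induction ht using Submodule.smul_induction_on' with
    | smul b hb t _ =>
      rw [smul_lie, lie_smul, smul_smul]
      exact Submodule.smul_mem_smul (Ideal.mul_mem_mul ha hb) Submodule.mem_top
    | add t _ t' _ h h' => rw [lie_add]; exact add_mem h h'
  | add z _ z' _ h h' => rw [add_lie]; exact add_mem h h'

variable {D}

theorem smul_mem_mapAlgebra {a : A} (ha : a ∈ D.invariants) {α : A ⊗[k] 𝔤}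
    (hα : α ∈ D.mapAlgebra) : a • α ∈ D.mapAlgebra := fun γ => by
  rw [onTensor_smul, ha γ, hα γ]

variable (D) in
/-- Multiplication by invariants on the equivariant map algebra. -/
def smulEnd : D.invariants →ₐ[k] Module.End k D.mapAlgebra :=
  AlgHom.ofLinearMap
    { toFun := fun a =>
        { toFun := fun α => ⟨a.1 • α.1, smul_mem_mapAlgebra a.2 α.2⟩
          map_add' := fun _ _ => Subtype.ext (smul_add _ _ _)
          map_smul' := fun _ _ => Subtype.ext (smul_comm _ _ _) }
      map_add' := fun _ _ => LinearMap.ext fun _ => Subtype.ext (add_smul _ _ _)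
      map_smul' := fun _ _ => LinearMap.ext fun _ => Subtype.ext (smul_assoc _ _ _) }
    (LinearMap.ext fun _ => Subtype.ext (one_smul _ _))
    (fun _ _ => LinearMap.ext fun _ => Subtype.ext (mul_smul _ _ _))

theorem smulEnd_lie (a : D.invariants) (α β : D.mapAlgebra) :
    ⁅D.smulEnd a α, β⁆ = ⁅α, D.smulEnd a β⁆ :=
  Subtype.ext (by
    change ⁅(a : A) • (α : A ⊗[k] 𝔤), (β : A ⊗[k] 𝔤)⁆ = ⁅(α : A ⊗[k] 𝔤), (a : A) • (β : A ⊗[k] 𝔤)⁆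
    rw [smul_lie, lie_smul])

theorem orbitSum_smul [Fintype Γ] {a : A} (ha : a ∈ D.invariants) (z : A ⊗[k] 𝔤) :
    D.orbitSum (a • z) = a • D.orbitSum z := by
  simp_rw [orbitSum_apply, onTensor_smul, ha _, Finset.smul_sum]

variable {σ : LieFDRep.{u, max v w, w₁} k D.mapAlgebra}

/-- Since $[a\alpha,\beta]=[\alpha,a\beta]$ acts by zero, $a\alpha$ commutes with the representation
and is a scalar by Schur; its trace is zero and the dimension is invertible. -/
theorem smulEnd_mem_ker [IsAlgClosed k] [CharZero k] (hσ : σ.IsIrreducible)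
    (htr : ∀ α : D.mapAlgebra, LinearMap.trace k _ (LieModule.toEnd k D.mapAlgebra σ.carrier α) = 0)
    (a : D.invariants) {α : D.mapAlgebra} (hα : LieModule.toEnd k D.mapAlgebra σ.carrier α = 0) :
    LieModule.toEnd k D.mapAlgebra σ.carrier (D.smulEnd a α) = 0 := by
  have h0 : ∀ m : σ.carrier, ⁅α, m⁆ = 0 := fun m => LinearMap.congr_fun hα m
  obtain ⟨c, hc⟩ := hσ.exists_eq_smul (LieModule.toEnd k D.mapAlgebra σ.carrier (D.smulEnd a α))
    fun β m => by
      have h := lie_lie (D.smulEnd a α) β m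
      rw [smulEnd_lie, lie_lie, h0, h0, lie_zero, sub_zero] at h
      exact (sub_eq_zero.1 h.symm)
  have hn := ((LieFDRep.isIrreducible_iff σ).1 hσ).1
  have h1 : LieModule.toEnd k D.mapAlgebra σ.carrier (D.smulEnd a α) = c • LinearMap.id :=
    LinearMap.ext hc
  have h2 := htr (D.smulEnd a α)
  rw [h1, map_smul, LinearMap.trace_id, smul_eq_mul, mul_eq_zero] at h2
  rw [h1, h2.resolve_right (Nat.cast_ne_zero.2 Module.finrank_pos.ne'), zero_smul]

/-- The ideal of invariants that multiply the whole equivariant map algebra into the kernel of a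
traceless irreducible representation has finite codimension. -/
theorem exists_ideal [IsAlgClosed k] [CharZero k] (hσ : σ.IsIrreducible)
    (htr : ∀ α : D.mapAlgebra, LinearMap.trace k _ (LieModule.toEnd k D.mapAlgebra σ.carrier α) = 0) :
    ∃ I : Ideal D.invariants, FiniteDimensional k (D.invariants ⧸ I) ∧
      ∀ a ∈ I, ∀ α, LieModule.toEnd k D.mapAlgebra σ.carrier (D.smulEnd a α) = 0 := by
  let K : Submodule k D.mapAlgebra := LinearMap.ker
    (LieModule.toEnd k D.mapAlgebra σ.carrier : D.mapAlgebra →ₗ[k] Module.End k σ.carrier)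
  have hK : ∀ a : D.invariants, K ≤ K.comap (D.smulEnd a) := fun a α hα =>
    smulEnd_mem_ker hσ htr a hα
  have : FiniteDimensional k (D.mapAlgebra ⧸ K) :=
    Module.Finite.equiv (LinearMap.quotKerEquivRange
      (LieModule.toEnd k D.mapAlgebra σ.carrier : D.mapAlgebra →ₗ[k] Module.End k σ.carrier)).symm
  -- The desired ideal is the kernel of the action of the invariants on $\mathfrak M/K$, which is
  -- finite-dimensional because it embeds in $\operatorname{End}V$.
  let Θ : D.invariants →ₐ[k] Module.End k (D.mapAlgebra ⧸ K) := AlgHom.ofLinearMap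
    { toFun := fun a => K.mapQ K (D.smulEnd a) (hK a)
      map_add' := fun a b => Submodule.linearMap_qext _ (by ext; simp)
      map_smul' := fun c a => Submodule.linearMap_qext _ (by ext; simp) }
    (Submodule.linearMap_qext _ (by ext; simp))
    (fun a b => Submodule.linearMap_qext _ (by ext; simp))
  refine ⟨RingHom.ker Θ, ?_, fun a ha α => ?_⟩
  · exact Module.Finite.of_injective (Ideal.kerLiftAlg Θ).toLinearMap (Ideal.kerLiftAlg_injective Θ)
  · have h : Θ a (K.mkQ α) = 0 := by
      rw [(RingHom.mem_ker).1 ha, LinearMap.zero_apply]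
    exact (Submodule.Quotient.mk_eq_zero K).1 h

/-- Passes from `I` to the ideal it generates in `A`, whose multiplications need not preserve
$\mathfrak M$. Averaging first repairs this: the average is linear over invariants and is $|\Gamma|$
times the identity on $\mathfrak M$. -/
theorem toEnd_eq_zero_of_mem_smul_top [CharZero k] [Finite Γ] {I : Ideal D.invariants}
    (hI : ∀ a ∈ I, ∀ α, LieModule.toEnd k D.mapAlgebra σ.carrier (D.smulEnd a α) = 0)
    {α : D.mapAlgebra}
    (hα : (α : A ⊗[k] 𝔤) ∈
      I.map (algebraMap D.invariants A) • (⊤ : Submodule A (A ⊗[k] 𝔤))) :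
    LieModule.toEnd k D.mapAlgebra σ.carrier α = 0 := by
  cases nonempty_fintype Γ
  let π : A ⊗[k] 𝔤 →ₗ[k] Module.End k σ.carrier :=
    (LieModule.toEnd k D.mapAlgebra σ.carrier : D.mapAlgebra →ₗ[k] Module.End k σ.carrier) ∘ₗ
      D.orbitSum.codRestrict D.mapAlgebra.toSubmodule D.orbitSum_mem
  have h1 : ∀ a ∈ I.map (algebraMap D.invariants A), ∀ z, π (a • z) = 0 := by
    intro a ha
    refine Submodule.span_induction ?_ ?_ ?_ ?_ ha
    · rintro _ ⟨a, ha, rfl⟩ z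
      have h2 := hI a ha ⟨D.orbitSum z, D.orbitSum_mem z⟩
      rw [← h2]
      change LieModule.toEnd k D.mapAlgebra σ.carrier _ = _
      congr 1
      exact Subtype.ext (orbitSum_smul a.2 z)
    · intro z; rw [zero_smul, map_zero]
    · intro a b _ _ ha hb z; rw [add_smul, map_add, ha, hb, add_zero]
    · intro c a _ ha z; rw [smul_eq_mul, mul_comm, mul_smul]; exact ha _
  have h2 : π α = 0 := by
    refine Submodule.smul_induction_on (p := fun z => π z = 0) hα (fun a ha z _ => h1 a ha z) ?_
    intro z t hz ht
    rw [map_add, hz, ht, add_zero]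
  have h3 : π α = (Fintype.card Γ : k) • LieModule.toEnd k D.mapAlgebra σ.carrier α := by
    rw [← map_smul]
    change LieModule.toEnd k D.mapAlgebra σ.carrier _ = _
    congr 1
    exact Subtype.ext (D.orbitSum_of_mem α.2)
  rw [h3] at h2
  exact (smul_eq_zero.1 h2).resolve_left (Nat.cast_ne_zero.2 Fintype.card_ne_zero)

/-- Let `J` be generated by the coordinates of `α` in a basis of $\mathfrak g$. By equivariance they
vanish on the whole orbits of the points, hence at every point over `I`. There are finitely many, so
`J` is finitely generated although `A` need not be Noetherian. -/
theorem exists_fg_le_radical [IsAlgClosed k] [Finite Γ] [FiniteDimensional k 𝔤]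
    {I : Ideal D.invariants} [FiniteDimensional k (D.invariants ⧸ I)] {n : ℕ}
    {x : Fin n → RatPoint k A}
    (hx : ∀ y : RatPoint k A, (∀ a ∈ I, y a = 0) → ∃ i, ∃ γ : Γ, D.actPoint γ (x i) = y)
    {α : D.mapAlgebra} (hα : ∀ i, D.ev (x i) α = 0) :
    ∃ J : Ideal A, J.FG ∧ J ≤ (I.map (algebraMap D.invariants A)).radical ∧
      (α : A ⊗[k] 𝔤) ∈ J • (⊤ : Submodule A (A ⊗[k] 𝔤)) := by
  let b := Module.finBasis k 𝔤
  let B := Algebra.TensorProduct.basis A b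
  refine ⟨Ideal.span (Set.range (B.repr α.1)), Submodule.fg_span (Set.finite_range _),
    Ideal.span_le.2 ?_, ?_⟩
  · rintro _ ⟨j, rfl⟩
    refine D.mem_radical_of_forall_point I fun y hy => ?_
    obtain ⟨i, γ, rfl⟩ := hx y hy
    have h1 : evalTensor (D.actPoint γ (x i)) α.1 = 0 := by
      have h2 := D.evalTensor_actPoint γ (x i) α.1
      rw [α.2 γ] at h2
      rw [h2, ← coe_ev, hα]
      exact map_zero (D.onLie γ)
    rw [← B.sum_repr α.1, map_sum] at h1
    simp only [evalTensor_smul, B, Algebra.TensorProduct.basis_apply, evalTensor_tmul, map_one,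
      one_smul] at h1
    exact Fintype.linearIndependent_iff.1 b.linearIndependent _ h1 j
  · rw [← B.sum_repr α.1]
    refine Submodule.sum_mem _ fun j _ => Submodule.smul_mem_smul (Ideal.subset_span ?_)
      Submodule.mem_top
    rw [B.sum_repr]
    exact ⟨j, rfl⟩

attribute [local instance] LieRing.ofAssociativeRing in
/-- A traceless irreducible representation factors through the evaluation at finitely many points
in distinct orbits. -/
theorem exists_points_of_traceless [IsAlgClosed k] [CharZero k] [Finite Γ] [FiniteDimensional k 𝔤]
    (hσ : σ.IsIrreducible)
    (htr : ∀ α : D.mapAlgebra,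
      LinearMap.trace k _ (LieModule.toEnd k D.mapAlgebra σ.carrier α) = 0) :
    ∃ (n : ℕ) (x : Fin n → RatPoint k A), D.DistinctOrbits x ∧
      ∀ α, (∀ i, D.ev (x i) α = 0) → LieModule.toEnd k D.mapAlgebra σ.carrier α = 0 := by
  obtain ⟨I, hIfin, hI⟩ := exists_ideal hσ htr
  obtain ⟨n, x, hx, hcover⟩ := D.exists_points_of_finite_quotient I
  refine ⟨n, x, hx, ?_⟩
  let L := (LieModule.toEnd k D.mapAlgebra σ.carrier).range
  let π : D.mapAlgebra →ₗ⁅k⁆ L := (LieModule.toEnd k D.mapAlgebra σ.carrier).rangeRestrict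
  have hπ : Function.Surjective π := LieHom.surjective_rangeRestrict _
  have hπ_apply : ∀ α (m : σ.carrier), ⁅π α, m⁆ = ⁅α, m⁆ := fun _ _ => rfl
  have : FiniteDimensional k L :=
    inferInstanceAs (FiniteDimensional k L.toSubmodule)
  have hn := ((LieFDRep.isIrreducible_iff σ).1 hσ).1
  have : LieModule.IsIrreducible k L σ.carrier := by
    refine LieModule.IsIrreducible.mk fun W hW => ?_
    rw [← LieSubmodule.toSubmodule_eq_top]
    exact (((LieFDRep.isIrreducible_iff σ).1 hσ).2 W.toSubmodule
      fun α m hm => W.lie_mem (x := π α) hm).resolve_left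
        fun h => hW ((LieSubmodule.toSubmodule_eq_bot W).1 h)
  -- The image of $\mathfrak M$ acts faithfully, irreducibly and without trace on a
  -- finite-dimensional space.
  have : LieAlgebra.HasTrivialRadical k L := by
    refine LieAlgebra.hasTrivialRadical_of_isIrreducible_of_isFaithful k L σ.carrier ?_
    intro l
    obtain ⟨α, rfl⟩ := hπ l
    exact htr α
  let N : LieIdeal k D.mapAlgebra :=
    { carrier := {α | ∀ i, D.ev (x i) α = 0}
      add_mem' := fun ha hb i => by rw [map_add, ha i, hb i, add_zero]
      zero_mem' := fun i => map_zero _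
      smul_mem' := fun c α ha i => by rw [map_smul, ha i, smul_zero]
      lie_mem := fun {β α} ha i => by
        rw [LieHom.map_lie, show D.ev (x i) α = 0 from ha i, lie_zero] }
  -- `S J` is the image in `L` of the elements of $\mathfrak M$ lying in $J\cdot(A\otimes\mathfrak
  -- g)$.
  let S : Ideal A → Submodule k L := fun J =>
    (((J • (⊤ : Submodule A (A ⊗[k] 𝔤))).restrictScalars k).comap
      D.mapAlgebra.toSubmodule.subtype).map (π : D.mapAlgebra →ₗ[k] L)
  have hSmono : ∀ {J J' : Ideal A}, J ≤ J' → S J ≤ S J' := fun h =>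
    Submodule.map_mono (Submodule.comap_mono fun z hz => Submodule.smul_mono_left h hz)
  -- Finite dimension of the image of `N` lets a single finitely generated `J` serve for all its
  -- elements.
  have hbase : ∃ J : Ideal A, J.FG ∧ J ≤ (I.map (algebraMap D.invariants A)).radical ∧
      (N.map π).toSubmodule ≤ S J := by
    have hfg : (N.map π).toSubmodule.FG := IsNoetherian.noetherian _
    suffices h : ∀ W : Submodule k L, W.FG → W ≤ (N.map π).toSubmodule →
        ∃ J : Ideal A, J.FG ∧ J ≤ (I.map (algebraMap D.invariants A)).radical ∧ W ≤ S J from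
      h _ hfg le_rfl
    intro W hW
    induction W, hW using Submodule.fg_induction with
    | singleton l =>
      intro hl
      rw [LieIdeal.coe_map_of_surjective hπ, Submodule.span_singleton_le_iff_mem] at hl
      obtain ⟨α, hα, rfl⟩ := hl
      obtain ⟨J, hJ, hJ', hαJ⟩ := exists_fg_le_radical hcover hα
      refine ⟨J, hJ, hJ', ?_⟩
      rw [Submodule.span_singleton_le_iff_mem]
      exact ⟨α, hαJ, rfl⟩
    | sup W₁ W₂ _ _ h₁ h₂ =>
      intro hl
      obtain ⟨J₁, hJ₁, hJ₁', h₁⟩ := h₁ (le_sup_left.trans hl)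
      obtain ⟨J₂, hJ₂, hJ₂', h₂⟩ := h₂ (le_sup_right.trans hl)
      exact ⟨J₁ ⊔ J₂, Submodule.FG.sup hJ₁ hJ₂, sup_le hJ₁' hJ₂',
        sup_le (h₁.trans (hSmono le_sup_left)) (h₂.trans (hSmono le_sup_right))⟩
  obtain ⟨J, hJfg, hJrad, hJ⟩ := hbase
  -- Brackets multiply the ideals, so each derived step squares the power of `J`.
  have hderived : ∀ m, (LieAlgebra.derivedSeriesOfIdeal k L m (N.map π)).toSubmodule ≤
      S (J ^ 2 ^ m) := by
    intro m
    induction m with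
    | zero => simpa using hJ
    | succ m ih =>
      rw [LieAlgebra.derivedSeriesOfIdeal_succ, LieSubmodule.lieIdeal_oper_eq_linear_span',
        Submodule.span_le]
      rintro _ ⟨a, ha, b, hb, rfl⟩
      obtain ⟨α, hα, rfl⟩ := ih ha
      obtain ⟨β, hβ, rfl⟩ := ih hb
      refine ⟨⁅α, β⁆, ?_, LieHom.map_lie π α β⟩
      rw [pow_succ, mul_two, pow_add]
      exact lie_mem_smul_top hα hβ
  -- A finitely generated ideal inside a radical has a power in the ideal itself; $m\le2^m$ makes
  -- the `m`-th derived term small enough.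
  obtain ⟨m, hm⟩ := Ideal.exists_pow_le_of_le_radical_of_fg hJrad hJfg
  have hzero : S (J ^ 2 ^ m) = ⊥ := by
    rw [Submodule.eq_bot_iff]
    rintro _ ⟨α, hα, rfl⟩
    exact Subtype.ext (toEnd_eq_zero_of_mem_smul_top hI
      (Submodule.smul_mono_left ((Ideal.pow_le_pow_right Nat.lt_two_pow_self.le).trans hm) hα))
  have hsolv : LieAlgebra.IsSolvable (N.map π) := by
    refine LieAlgebra.IsSolvable.mk (R := k) (k := m)
      ((LieIdeal.derivedSeries_eq_bot_iff _ _).2 ?_)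
    rw [← LieSubmodule.toSubmodule_eq_bot, eq_bot_iff, ← hzero]
    exact hderived m
  have hbot : N.map π = ⊥ := by
    rw [eq_bot_iff, ← LieAlgebra.HasTrivialRadical.radical_eq_bot (R := k) (L := L)]
    exact (LieAlgebra.LieIdeal.solvable_iff_le_radical k L _).1 hsolv
  intro α hα
  have h1 : π α ∈ N.map π := LieIdeal.mem_map (show α ∈ N from hα)
  rw [hbot, LieSubmodule.mem_bot] at h1
  exact congrArg Subtype.val h1

end EquivariantPair

/-! ### Functoriality of isomorphism classes -/

namespace LieRepClass

variable {k : Type u} [Field k] {L : Type v} [LieRing L] [LieAlgebra k L]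
  {L' : Type w} [LieRing L'] [LieAlgebra k L'] {L'' : Type w'} [LieRing L''] [LieAlgebra k L'']

theorem comap_comp (f : L →ₗ⁅k⁆ L') (g : L' →ₗ⁅k⁆ L'') (c : LieRepClass k L'') :
    comap (g.comp f) c = comap f (comap g c) := by
  obtain ⟨ρ, rfl⟩ := exists_eq_mk c
  exact mk_eq_mk.2 (LieFDRep.Iso.of_linearEquiv (ρ := ρ.comap (g.comp f))
    (σ := (ρ.comap g).comap f) (LinearEquiv.refl k ρ.carrier) fun _ _ => rfl)

theorem comap_id (c : LieRepClass k L) : comap (LieHom.id : L →ₗ⁅k⁆ L) c = c := by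
  obtain ⟨ρ, rfl⟩ := exists_eq_mk c
  exact mk_eq_mk.2 (LieFDRep.Iso.of_linearEquiv (ρ := ρ.comap LieHom.id) (σ := ρ)
    (LinearEquiv.refl k ρ.carrier) fun _ _ => rfl)

theorem dim_comap (f : L →ₗ⁅k⁆ L') (c : LieRepClass k L') : (comap f c).dim = c.dim := by
  obtain ⟨ρ, rfl⟩ := exists_eq_mk c
  rfl

theorem IsIrreducible.comap {f : L →ₗ⁅k⁆ L'} (hf : Function.Surjective f)
    {c : LieRepClass k L'} (hc : c.IsIrreducible) : (comap f c).IsIrreducible := by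
  obtain ⟨ρ, rfl⟩ := exists_eq_mk c
  have h := (LieFDRep.isIrreducible_iff ρ).1 hc
  refine (LieFDRep.isIrreducible_iff (ρ.comap f)).2 ⟨h.1, fun W hW => h.2 W fun x m hm => ?_⟩
  obtain ⟨y, rfl⟩ := hf x
  exact hW y m hm

theorem tensor_trivial (c : LieRepClass k L) : c.tensor trivial = c := by
  obtain ⟨ρ, rfl⟩ := exists_eq_mk c
  rw [trivial, mk_tensor_ofDual]
  exact mk_eq_mk.2 (LieFDRep.twist_zero_iso ρ)

theorem ofDual_tensor_ofDual_tensor (lam mu : AbDual k L) (c : LieRepClass k L) :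
    (ofDual lam).tensor ((ofDual mu).tensor c) =
      (ofDual (lam + mu : AbDual k L)).tensor c := by
  obtain ⟨ρ, rfl⟩ := exists_eq_mk c
  rw [ofDual_tensor_mk, ofDual_tensor_mk, ofDual_tensor_mk]
  exact mk_eq_mk.2 (LieFDRep.twist_twist_iso lam mu ρ)

end LieRepClass

/-! ### Classification up to a twist, and comparison of two twists -/

namespace EquivariantPair

variable {k : Type u} {A : Type v} {𝔤 : Type w} {Γ : Type w'}
  [Field k] [CommRing A] [Algebra k A] [LieRing 𝔤] [LieAlgebra k 𝔤] [Group Γ]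
  {D : EquivariantPair k A 𝔤 Γ}

/-- An element killed by all evaluations at the given points is the difference between `α` and the
sum of the sections applied to its values. -/
theorem ev_sub_sum_section {n : ℕ} {x : Fin n → RatPoint k A}
    {s : ∀ i, D.isotropy (x i) →ₗ[k] D.mapAlgebra} (hs : ∀ i u, D.ev (x i) (s i u) = u)
    (hs' : ∀ i j, i ≠ j → ∀ u, D.ev (x j) (s i u) = 0) (α : D.mapAlgebra) (j : Fin n) :
    D.ev (x j) (α - ∑ i, s i (D.ev (x i) α)) = 0 := by
  rw [map_sub, map_sum, Finset.sum_eq_single j (fun i _ hi => hs' i j hi _) (by simp), hs, sub_self]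

/-- The sections are Lie homomorphisms modulo the common kernel of the evaluations, which is all
that a representation factoring through them can see. -/
theorem ev_section_lie {n : ℕ} {x : Fin n → RatPoint k A}
    {s : ∀ i, D.isotropy (x i) →ₗ[k] D.mapAlgebra} (hs : ∀ i u, D.ev (x i) (s i u) = u)
    (hs' : ∀ i j, i ≠ j → ∀ u, D.ev (x j) (s i u) = 0) (i : Fin n) (a b : D.isotropy (x i))
    (j : Fin n) : D.ev (x j) (s i ⁅a, b⁆ - ⁅s i a, s i b⁆) = 0 := by
  rw [map_sub, LieHom.map_lie]
  by_cases hij : i = j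
  · subst hij
    rw [hs, hs, hs, sub_self]
  · rw [hs' i j hij, hs' i j hij, hs' i j hij, lie_zero, sub_self]

/-- Every irreducible representation is a twist of an evaluation representation. -/
theorem exists_twist_evRep_iso [IsAlgClosed k] [CharZero k] [Finite Γ] [FiniteDimensional k 𝔤]
    {σ : LieFDRep.{u, max v w, u} k D.mapAlgebra} (hσ : σ.IsIrreducible) :
    ∃ (lam : AbDual k D.mapAlgebra) (n : ℕ) (x : Fin n → RatPoint k A)
      (ρ : ∀ i, LieFDRep.{u, w, u} k (D.isotropy (x i))),
      D.DistinctOrbits x ∧ (∀ i, (ρ i).IsIrreducible) ∧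
        (LieFDRep.twist lam (D.evRep x ρ)).Iso σ := by
  have hn := ((LieFDRep.isIrreducible_iff σ).1 hσ).1
  have hd : (Module.finrank k σ.carrier : k) ≠ 0 := Nat.cast_ne_zero.2 Module.finrank_pos.ne'
  -- The normalised trace: it vanishes on brackets, and subtracting it leaves a traceless
  -- representation.
  obtain ⟨τ, hτ⟩ := AbDual.exists_eval_eq
    ((Module.finrank k σ.carrier : k)⁻¹ • LinearMap.trace k σ.carrier ∘ₗ
      (LieModule.toEnd k D.mapAlgebra σ.carrier : D.mapAlgebra →ₗ[k] Module.End k σ.carrier))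
    (fun α β => by
      simp [LieHom.map_lie, Ring.lie_def, LinearMap.trace_mul_comm k
        (LieModule.toEnd k D.mapAlgebra σ.carrier α)])
  let σ' : LieFDRep.{u, max v w, u} k D.mapAlgebra := LieFDRep.twist (-τ : AbDual k D.mapAlgebra) σ
  have hσ' : σ'.IsIrreducible := hσ.twist _
  have htr : ∀ α : D.mapAlgebra,
      LinearMap.trace k _ (LieModule.toEnd k D.mapAlgebra σ'.carrier α) = 0 := by
    intro α
    have h1 : LinearMap.trace k σ.carrier (LieModule.toEnd k D.mapAlgebra σ.carrier α +
        (-τ : AbDual k D.mapAlgebra).eval α • LinearMap.id) = 0 := by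
      rw [map_add, map_smul, LinearMap.trace_id, AbDual.eval_neg, LinearMap.neg_apply, hτ]
      simp [mul_right_comm, inv_mul_cancel₀ hd]
    exact h1
  obtain ⟨n, x, hx, hker⟩ := exists_points_of_traceless hσ' htr
  obtain ⟨s, hs, hs'⟩ := exists_ev_section hx
  let π : D.mapAlgebra →ₗ[k] Module.End k σ'.carrier :=
    (LieModule.toEnd k D.mapAlgebra σ'.carrier : D.mapAlgebra →ₗ[k] Module.End k σ'.carrier)
  have hπ : ∀ α β, π ⁅α, β⁆ = π α * π β - π β * π α := fun α β =>
    LinearMap.ext fun m => lie_lie (M := σ'.carrier) α β m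
  have hn' : Nontrivial σ'.carrier := hn
  -- The maps `π ∘ₗ s i` are commuting representations of the $\mathfrak g^{x_i}$: every failure is
  -- an element on which all evaluations vanish, hence `π` too.
  obtain ⟨ρ, f, hρ, hf, hf'⟩ := LieFDRep.exists_irreducible_multilinear (fun i => π ∘ₗ s i)
    (fun i a b => by
      have h1 := hker _ (ev_section_lie hs hs' i a b)
      have h2 : π (s i ⁅a, b⁆) = π ⁅s i a, s i b⁆ := by
        rw [← sub_eq_zero, ← map_sub]; exact h1
      simp only [LinearMap.comp_apply]
      rw [h2, hπ])
    (fun i j hij a b => by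
      have h1 := hker ⁅s i a, s j b⁆ fun l => by
        rw [LieHom.map_lie]
        by_cases hl : i = l
        · rw [hs' j l (fun h => hij (hl.trans h.symm)), lie_zero]
        · rw [hs' i l hl, zero_lie]
      exact sub_eq_zero.1 ((hπ _ _).symm.trans h1))
  have h1 : (D.evRep x ρ).Iso σ' := by
    refine evRep_iso_of_multilinear hx hρ hσ' f hf fun α m => ?_
    have h2 := hker _ (ev_sub_sum_section hs hs' α)
    have h3 : π α = ∑ i, π (s i (D.ev (x i) α)) := by
      rw [← map_sum, ← sub_eq_zero, ← map_sub]; exact h2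
    simp only [hf']
    refine (LinearMap.congr_fun h3 (f m)).trans ?_
    rw [LinearMap.sum_apply]
    rfl
  refine ⟨τ, n, x, ρ, hx, hρ, (h1.twist τ).trans ((LieFDRep.twist_twist_iso _ _ _).trans ?_)⟩
  rw [add_neg_cancel]
  exact LieFDRep.twist_zero_iso σ

/-- On the common kernel of the evaluations the two sides act by the scalars $\lambda$ and
$\lambda'$, so $\lambda-\lambda'$ factors through the evaluations as
$\sum_i\varphi_i\circ\mathrm{ev}_{x_i}$. The element `s i u` acts in slot `i` alone up to these
scalars, and freezing the other slots of the isomorphism compares the `i`-th factors. -/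
theorem exists_characters [IsAlgClosed k] [CharZero k] [Finite Γ] {n : ℕ}
    {x : Fin n → RatPoint k A} (hx : D.DistinctOrbits x)
    {ρ ρ' : ∀ i, LieFDRep.{u, w, u} k (D.isotropy (x i))} (hρ : ∀ i, (ρ i).IsIrreducible)
    (hρ' : ∀ i, (ρ' i).IsIrreducible) {lam lam' : AbDual k D.mapAlgebra}
    (h : (LieFDRep.twist lam (D.evRep x ρ)).Iso (LieFDRep.twist lam' (D.evRep x ρ'))) :
    ∃ φ : ∀ i, AbDual k (D.isotropy (x i)), (∀ i, (LieFDRep.twist (φ i) (ρ i)).Iso (ρ' i)) ∧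
      ∀ α, (lam - lam' : AbDual k D.mapAlgebra).eval α = ∑ i, (φ i).eval (D.ev (x i) α) := by
  obtain ⟨s, hs, hs'⟩ := exists_ev_section hx
  obtain ⟨e, he⟩ := h.exists_linearEquiv
  change (⨂[k] i, (ρ i).carrier) ≃ₗ[k] (⨂[k] i, (ρ' i).carrier) at e
  have hn : Nontrivial (⨂[k] i, (ρ i).carrier) :=
    ((LieFDRep.isIrreducible_iff _).1 (isIrreducible_evRep hx hρ)).1
  have he' : ∀ (α : D.mapAlgebra) i, (∀ j, j ≠ i → D.ev (x j) α = 0) → ∀ z,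
      e (PiTensorProduct.mapMonoidHom (R := k) (s := fun i => (ρ i).carrier)
        (Pi.mulSingle i (LieModule.toEnd k _ (ρ i).carrier (D.ev (x i) α))) z) +
          lam.eval α • e z =
      PiTensorProduct.mapMonoidHom (R := k) (s := fun i => (ρ' i).carrier)
        (Pi.mulSingle i (LieModule.toEnd k _ (ρ' i).carrier (D.ev (x i) α))) (e z) +
          lam'.eval α • e z := by
    intro α i hα z
    have h1 := evRep_lie_eq_single (ρ := ρ) α i hα z
    have h2 := evRep_lie_eq_single (ρ := ρ') α i hα (e z)
    rw [← map_smul, ← map_add]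
    refine Eq.trans ?_ ((he α z).trans ?_)
    · exact congrArg (fun y : ⨂[k] i, (ρ i).carrier => e (y + lam.eval α • z)) h1.symm
    · exact congrArg (fun y : ⨂[k] i, (ρ' i).carrier => y + lam'.eval α • e z) h2
  have hvan : ∀ α : D.mapAlgebra, (∀ i, D.ev (x i) α = 0) →
      (lam - lam' : AbDual k D.mapAlgebra).eval α = 0 := by
    intro α hα
    obtain ⟨z, hz⟩ := exists_ne (0 : ⨂[k] i, (ρ i).carrier)
    have h0 : ∀ (τ : ∀ i, LieFDRep.{u, w, u} k (D.isotropy (x i))) (y : ⨂[k] i, (τ i).carrier),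
        (⁅α, (y : (D.evRep x τ).carrier)⁆ : (D.evRep x τ).carrier) = (0 : ⨂[k] i, (τ i).carrier) := by
      intro τ y
      refine (evRep_lie α y).trans (Finset.sum_eq_zero fun i _ => ?_)
      rw [hα, map_zero, PiTensorProduct.mapMonoidHom_mulSingle_zero, LinearMap.zero_apply]
      rfl
    have h1 : e (lam.eval α • z) = lam'.eval α • e z := by
      refine Eq.trans ?_ ((he α z).trans ?_)
      · refine congrArg e ?_
        refine (zero_add (lam.eval α • z)).symm.trans ?_
        exact congrArg (fun y : ⨂[k] i, (ρ i).carrier => y + lam.eval α • z) (h0 ρ z).symm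
      · refine Eq.trans ?_ (zero_add (lam'.eval α • e z))
        exact congrArg (fun y : ⨂[k] i, (ρ' i).carrier => y + lam'.eval α • e z) (h0 ρ' (e z))
    rw [← map_smul] at h1
    rw [AbDual.eval_sub, LinearMap.sub_apply, sub_eq_zero]
    exact smul_left_injective k hz (e.injective h1)
  -- The composite with `s i` kills brackets because `lam - lam'` vanishes on the bracket defect of
  -- `s i`.
  obtain ⟨φ, hφ⟩ : ∃ φ : ∀ i, AbDual k (D.isotropy (x i)),
      ∀ i, (φ i).eval = (lam - lam' : AbDual k D.mapAlgebra).eval ∘ₗ s i := by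
    have h1 : ∀ i, ∃ φ : AbDual k (D.isotropy (x i)),
        φ.eval = (lam - lam' : AbDual k D.mapAlgebra).eval ∘ₗ s i := fun i => by
      refine AbDual.exists_eval_eq _ fun a b => ?_
      have h2 := hvan _ (ev_section_lie hs hs' i a b)
      rwa [map_sub, AbDual.eval_lie, sub_zero] at h2
    choose φ hφ using h1
    exact ⟨φ, hφ⟩
  refine ⟨φ, fun i => ?_, fun α => ?_⟩
  · obtain ⟨f, hf, hf'⟩ := PiTensorProduct.exists_linearMap_ne_zero e.toLinearMap
      (fun h0 => by
        obtain ⟨z, hz⟩ := exists_ne (0 : ⨂[k] i, (ρ i).carrier)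
        exact hz (e.injective ((LinearMap.congr_fun h0 z).trans (map_zero e).symm))) i
    refine ((hρ i).twist (φ i)).iso_of_ne_zero (hρ' i) f (fun a v => ?_) hf
    -- The scalar $\varphi_i(a)=(\lambda-\lambda')(s_i a)$ is moved to the source side, turning
    -- $\rho_i$ into its twist.
    refine hf' (LieModule.toEnd k _ (ρ i).carrier a + (φ i).eval a • 1)
      (LieModule.toEnd k _ (ρ' i).carrier a) (fun z => ?_) v
    have h1 := he' (s i a) i (fun j hj => hs' i j hj.symm a) z
    rw [hs] at h1
    rw [PiTensorProduct.mapMonoidHom_mulSingle_add,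
      PiTensorProduct.mapMonoidHom_mulSingle_smul_one, hφ]
    simp only [LinearMap.add_apply, LinearMap.smul_apply, Module.End.one_apply, map_add, map_smul,
      LinearEquiv.coe_coe, LinearMap.comp_apply, AbDual.eval_sub, LinearMap.sub_apply, sub_smul, map_sub]
    rw [← add_sub_assoc, h1, add_sub_cancel_right]
  · have h2 := hvan _ (ev_sub_sum_section hs hs' α)
    rw [map_sub, sub_eq_zero] at h2
    rw [h2, map_sum]
    exact Finset.sum_congr rfl fun i _ => by rw [hφ]; rfl

end EquivariantPair

/-! ### Orbits, and equivariant functions with prescribed values -/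

namespace EquivariantPair

variable {k : Type u} {A : Type v} {𝔤 : Type w} {Γ : Type w'}
  [Field k] [CommRing A] [Algebra k A] [LieRing 𝔤] [LieAlgebra k 𝔤] [Group Γ]
  {D : EquivariantPair k A 𝔤 Γ}

/-- The orbit relation on rational points. -/
def orbitSetoid (D : EquivariantPair k A 𝔤 Γ) : Setoid (RatPoint k A) where
  r x y := ∃ γ : Γ, D.actPoint γ x = y
  iseqv :=
    { refl := fun x => ⟨1, D.actPoint_one x⟩
      symm := by
        rintro x _ ⟨γ, rfl⟩
        exact ⟨γ⁻¹, by rw [← D.actPoint_mul, inv_mul_cancel, D.actPoint_one]⟩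
      trans := by
        rintro x _ _ ⟨γ, rfl⟩ ⟨δ, rfl⟩
        exact ⟨δ * γ, D.actPoint_mul δ γ x⟩ }

theorem exists_distinctOrbits_cover {S : Set (RatPoint k A)} (hS : S.Finite) :
    ∃ (n : ℕ) (x : Fin n → RatPoint k A), D.DistinctOrbits x ∧
      ∀ y ∈ S, ∃ i, ∃ γ : Γ, D.actPoint γ (x i) = y := by
  let T : Set (Quotient D.orbitSetoid) := Quotient.mk D.orbitSetoid '' S
  have : Finite T := hS.image _
  obtain ⟨n, ⟨e⟩⟩ := Finite.exists_equiv_fin T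
  refine ⟨n, fun i => Quotient.out (e.symm i).1, fun i j h => ?_, fun y hy => ?_⟩
  · have h1 := Quotient.sound (s := D.orbitSetoid) h
    rw [Quotient.out_eq, Quotient.out_eq] at h1
    exact e.symm.injective (Subtype.ext h1)
  · refine ⟨e ⟨Quotient.mk _ y, y, hy, rfl⟩, ?_⟩
    refine Quotient.exact (s := D.orbitSetoid) ?_
    change Quotient.mk _ (Quotient.out (e.symm (e ⟨Quotient.mk _ y, _⟩)).1) = _
    rw [Quotient.out_eq, Equiv.symm_apply_apply]

/-- The isomorphism `𝔤^y → 𝔤^x`, `u ↦ γ⁻¹ u`, for `y = γ x`. -/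
def transportOf (D : EquivariantPair k A 𝔤 Γ) {x y : RatPoint k A} (γ : Γ)
    (h : D.actPoint γ x = y) : D.isotropy y →ₗ⁅k⁆ D.isotropy x where
  toFun u := ⟨D.onLie γ⁻¹ u.1, D.onLie_inv_mem γ x (h.symm ▸ u.2)⟩
  map_add' u v := Subtype.ext (map_add (D.onLie γ⁻¹) u.1 v.1)
  map_smul' c u := Subtype.ext (map_smul (D.onLie γ⁻¹) c u.1)
  map_lie' {u v} := Subtype.ext (D.onLie_lie γ⁻¹ u.1 v.1)

theorem transportOf_apply {x y : RatPoint k A} (γ : Γ) (h : D.actPoint γ x = y)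
    (u : D.isotropy y) : (D.transportOf γ h u : 𝔤) = D.onLie γ⁻¹ u := rfl

/-- The quotient $\gamma\delta^{-1}$ stabilizes `y`, so it fixes $\mathfrak g^y$ pointwise. This
makes equivariant extension along an orbit well defined. -/
theorem transportOf_congr {x y : RatPoint k A} {γ δ : Γ} (h : D.actPoint γ x = y)
    (h' : D.actPoint δ x = y) : D.transportOf γ h = D.transportOf δ h' := by
  refine LieHom.ext fun u => Subtype.ext ?_
  rw [transportOf_apply, transportOf_apply]
  have h1 := u.2 (γ * δ⁻¹) (by
    rw [D.actPoint_mul, (D.actPoint_inv_eq_iff δ y x).2 h', h])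
  conv_lhs => rw [← h1]
  rw [← LinearEquiv.mul_apply, ← map_mul, inv_mul_cancel_left]

theorem transportOf_comp {x y z : RatPoint k A} (γ δ : Γ) (h : D.actPoint γ x = y)
    (h' : D.actPoint δ y = z) : (D.transportOf γ h).comp (D.transportOf δ h') =
      D.transportOf (δ * γ) (by rw [D.actPoint_mul, h, h']) := by
  refine LieHom.ext fun u => Subtype.ext ?_
  change D.onLie γ⁻¹ (D.onLie δ⁻¹ u) = D.onLie (δ * γ)⁻¹ u
  rw [← LinearEquiv.mul_apply, ← map_mul, mul_inv_rev]

theorem transportOf_one (x : RatPoint k A) :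
    D.transportOf 1 (D.actPoint_one x) = LieHom.id := by
  refine LieHom.ext fun u => Subtype.ext ?_
  rw [transportOf_apply, inv_one, map_one]
  rfl

theorem transportOf_surjective {x y : RatPoint k A} (γ : Γ) (h : D.actPoint γ x = y) :
    Function.Surjective (D.transportOf γ h) := fun u => by
  have h' := (D.actPoint_inv_eq_iff γ y x).2 h
  refine ⟨D.transportOf γ⁻¹ h' u, ?_⟩
  rw [← LieHom.comp_apply, transportOf_comp, transportOf_congr _ (D.actPoint_one x),
    transportOf_one]
  rfl

theorem dim_evRep {n : ℕ} (x : Fin n → RatPoint k A)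
    (ρ : ∀ i, LieFDRep.{u, w, u} k (D.isotropy (x i))) :
    (D.evRep x ρ).dim = ∏ i, (ρ i).dim := by
  refine (Module.finrank_eq_card_basis
    (Basis.piTensorProduct fun i => Module.finBasis k (ρ i).carrier)).trans ?_
  rw [Fintype.card_pi]
  simp only [Fintype.card_fin]
  rfl

namespace ClassFun

section OfPoints

variable {n : ℕ} {x : Fin n → RatPoint k A}

open Classical in
/-- The values of the equivariant function with prescribed values at representatives of finitely
many orbits, trivial elsewhere. -/
def ofPointsFun (x : Fin n → RatPoint k A) (c : ∀ i, LieRepClass k (D.isotropy (x i)))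
    (y : RatPoint k A) : LieRepClass k (D.isotropy y) :=
  if h : ∃ p : Fin n × Γ, D.actPoint p.2 (x p.1) = y then
    LieRepClass.comap (D.transportOf h.choose.2 h.choose_spec) (c h.choose.1)
  else LieRepClass.trivial

theorem ofPointsFun_of_not_exists (c : ∀ i, LieRepClass k (D.isotropy (x i))) {y : RatPoint k A}
    (h : ¬∃ p : Fin n × Γ, D.actPoint p.2 (x p.1) = y) :
    ofPointsFun x c y = LieRepClass.trivial := dif_neg h

/-- The arbitrary choice in the definition is harmless: distinct orbits determine `i`, and the
transport does not depend on the group element. -/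
theorem ofPointsFun_of_eq (hx : D.DistinctOrbits x) (c : ∀ i, LieRepClass k (D.isotropy (x i)))
    {i : Fin n} {γ : Γ} {y : RatPoint k A} (hy : D.actPoint γ (x i) = y) :
    ofPointsFun x c y = LieRepClass.comap (D.transportOf γ hy) (c i) := by
  have h : ∃ p : Fin n × Γ, D.actPoint p.2 (x p.1) = y := ⟨(i, γ), hy⟩
  have key : ∀ (j : Fin n) (δ : Γ) (hj : D.actPoint δ (x j) = y),
      LieRepClass.comap (D.transportOf δ hj) (c j) =
        LieRepClass.comap (D.transportOf γ hy) (c i) := by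
    intro j δ hj
    obtain rfl : i = j := hx i j ⟨δ⁻¹ * γ, by
      rw [D.actPoint_mul, hy, (D.actPoint_inv_eq_iff δ _ _).2 hj]⟩
    rw [transportOf_congr hj hy]
  exact (dif_pos h).trans (key _ _ h.choose_spec)

/-- The equivariant function with prescribed values at representatives of finitely many orbits,
trivial elsewhere. -/
def ofPoints [Finite Γ] (hx : D.DistinctOrbits x) (c : ∀ i, LieRepClass k (D.isotropy (x i))) :
    D.ClassFun where
  toFun := ofPointsFun x c
  equivariant γ y := by
    by_cases h : ∃ p : Fin n × Γ, D.actPoint p.2 (x p.1) = y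
    · obtain ⟨⟨i, δ⟩, hδ⟩ := h
      have hδ' : D.actPoint (γ * δ) (x i) = D.actPoint γ y := by rw [D.actPoint_mul, ← hδ]
      rw [ofPointsFun_of_eq hx c hδ, ofPointsFun_of_eq hx c hδ', ← LieRepClass.comap_comp]
      exact congrArg (fun f => LieRepClass.comap f (c i)) (transportOf_comp δ γ hδ rfl).symm
    · rw [ofPointsFun_of_not_exists c h, LieRepClass.comap_trivial, ofPointsFun_of_not_exists]
      rintro ⟨⟨i, δ⟩, hδ⟩
      exact h ⟨(i, γ⁻¹ * δ), by rw [D.actPoint_mul, (D.actPoint_inv_eq_iff γ _ _).2 hδ.symm]⟩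
  finite_support := by
    refine (Set.finite_range fun p : Fin n × Γ => D.actPoint p.2 (x p.1)).subset fun y hy => ?_
    by_contra h
    exact hy (ofPointsFun_of_not_exists c h)

variable [Finite Γ] (hx : D.DistinctOrbits x) (c : ∀ i, LieRepClass k (D.isotropy (x i)))

theorem ofPoints_apply (i : Fin n) : (ofPoints hx c).toFun (x i) = c i := by
  refine (ofPointsFun_of_eq hx c (D.actPoint_one (x i))).trans ?_
  rw [transportOf_one, LieRepClass.comap_id]

theorem ofPoints_cover (y : RatPoint k A) (hy : (ofPoints hx c).toFun y ≠ LieRepClass.trivial) :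
    ∃ i, ∃ γ : Γ, D.actPoint γ (x i) = y := by
  by_contra h
  exact hy (ofPointsFun_of_not_exists c fun ⟨p, hp⟩ => h ⟨p.1, p.2, hp⟩)

theorem ofPoints_mem_irredFun (hc : ∀ i, (c i).IsIrreducible) :
    ofPoints hx c ∈ D.irredFun := by
  intro y
  by_cases h : (ofPoints hx c).toFun y = LieRepClass.trivial
  · rw [h]
    exact LieRepClass.isIrreducible_ofDual 0
  · obtain ⟨i, γ, hy⟩ := ofPoints_cover hx c y h
    rw [show (ofPoints hx c).toFun y = _ from ofPointsFun_of_eq hx c hy]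
    exact (hc i).comap (transportOf_surjective γ hy)

end OfPoints

theorem eq_of_cover {Ψ Φ : D.ClassFun} {n : ℕ} {x : Fin n → RatPoint k A}
    (hΨ : ∀ y, Ψ.toFun y ≠ LieRepClass.trivial → ∃ i, ∃ γ : Γ, D.actPoint γ (x i) = y)
    (hΦ : ∀ y, Φ.toFun y ≠ LieRepClass.trivial → ∃ i, ∃ γ : Γ, D.actPoint γ (x i) = y)
    (h : ∀ i, Ψ.toFun (x i) = Φ.toFun (x i)) : Ψ = Φ := by
  refine ClassFun.ext (funext fun y => ?_)
  by_cases hy : ∃ i, ∃ γ : Γ, D.actPoint γ (x i) = y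
  · obtain ⟨i, γ, rfl⟩ := hy
    rw [Ψ.equivariant, Φ.equivariant, h]
  · rw [not_not.1 fun h' => hy (hΨ y h'), not_not.1 fun h' => hy (hΦ y h')]

theorem exists_evClass_eq [IsAlgClosed k] [CharZero k] [Finite Γ] {Ψ : D.ClassFun}
    (hΨ : Ψ ∈ D.irredFun) {n : ℕ} {x : Fin n → RatPoint k A} (hx : D.DistinctOrbits x)
    (hcover : ∀ y, Ψ.toFun y ≠ LieRepClass.trivial → ∃ i, ∃ γ : Γ, D.actPoint γ (x i) = y) :
    ∃ ρ : ∀ i, LieFDRep.{u, w, u} k (D.isotropy (x i)), (∀ i, (ρ i).IsIrreducible) ∧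
      (∀ i, LieRepClass.mk (ρ i) = Ψ.toFun (x i)) ∧
      Ψ.evClass = LieRepClass.mk (D.evRep x ρ) := by
  choose ρ hρ using fun i => LieRepClass.exists_eq_mk (Ψ.toFun (x i))
  refine ⟨ρ, fun i => ?_, hρ, evClass_eq_of_cover hΨ hx hcover hρ⟩
  rw [← LieRepClass.isIrreducible_mk, hρ]
  exact hΨ _

theorem isIrreducible_ofDual_tensor_evClass [IsAlgClosed k] [CharZero k] [Finite Γ]
    (lam : AbDual k D.mapAlgebra) {Ψ : D.ClassFun} (hΨ : Ψ ∈ D.irredFun) :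
    ((LieRepClass.ofDual lam).tensor Ψ.evClass).IsIrreducible := by
  obtain ⟨n, x, hx, hcover⟩ := D.exists_distinctOrbits_cover Ψ.finite_support
  obtain ⟨ρ, hρ, -, h⟩ := exists_evClass_eq hΨ hx hcover
  rw [h, LieRepClass.ofDual_tensor_mk]
  exact (isIrreducible_evRep hx hρ).twist lam

/-- The dimension of the evaluation representation is the product of the dimensions at
representatives, so each factor divides $1$; equivariance carries this along the orbits. -/
theorem dim_eq_one_of_dim_evClass_eq_one {Φ : D.ClassFun} (h : Φ.evClass.dim = 1)
    (y : RatPoint k A) : (Φ.toFun y).dim = 1 := by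
  by_cases hy : Φ.toFun y = LieRepClass.trivial
  · rw [hy]
    exact LieRepClass.dim_ofDual 0
  obtain ⟨n, x, hx⟩ := Φ.exists_isTransversal
  choose ρ hρ using fun i => LieRepClass.exists_eq_mk (Φ.toFun (x i))
  rw [Φ.evClass_eq hx ρ hρ] at h
  have h1 : ∏ i, (ρ i).dim = 1 := (dim_evRep x ρ).symm.trans h
  obtain ⟨i, ⟨γ, rfl⟩, -⟩ := hx.2 y hy
  rw [Φ.equivariant, LieRepClass.dim_comap, ← hρ]
  exact Nat.dvd_one.1 (h1 ▸ Finset.dvd_prod_of_mem _ (Finset.mem_univ i))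

theorem tensor_mem_irredFun {Ψ Φ : D.ClassFun} (hΨ : Ψ ∈ D.irredFun) (h : Φ.evClass.dim = 1) :
    Ψ.tensor Φ ∈ D.irredFun := by
  intro y
  obtain ⟨φ, hφ⟩ := LieRepClass.exists_ofDual_eq (dim_eq_one_of_dim_evClass_eq_one h y)
  obtain ⟨ρ, hρ⟩ := LieRepClass.exists_eq_mk (Ψ.toFun y)
  change ((Ψ.toFun y).tensor (Φ.toFun y)).IsIrreducible
  have h1 := hΨ y
  rw [← hρ] at h1
  rw [← hφ, ← hρ, LieRepClass.mk_tensor_ofDual]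
  exact LieFDRep.IsIrreducible.twist h1 φ

theorem tensor_cover {Ψ Φ : D.ClassFun} {y : RatPoint k A}
    (hy : (Ψ.tensor Φ).toFun y ≠ LieRepClass.trivial) :
    Ψ.toFun y ≠ LieRepClass.trivial ∨ Φ.toFun y ≠ LieRepClass.trivial := by
  by_contra! h
  refine hy ?_
  change (Ψ.toFun y).tensor (Φ.toFun y) = _
  rw [h.1, h.2, LieRepClass.trivial_tensor_trivial]

theorem zero_mem_irredFun : zero D ∈ D.irredFun := fun _ => LieRepClass.isIrreducible_ofDual 0

/-! ### Tensoring with a one-dimensional evaluation class, fibres and injectivity -/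

section

variable [IsAlgClosed k] [CharZero k] [Finite Γ]

theorem evClass_eq_ofDual {Φ : D.ClassFun} (hΦ : Φ ∈ D.irredFun) {n : ℕ}
    {x : Fin n → RatPoint k A} (hx : D.DistinctOrbits x)
    (hcover : ∀ y, Φ.toFun y ≠ LieRepClass.trivial → ∃ i, ∃ γ : Γ, D.actPoint γ (x i) = y)
    {φ : ∀ i, AbDual k (D.isotropy (x i))} (hφ : ∀ i, LieRepClass.ofDual (φ i) = Φ.toFun (x i))
    {mu : AbDual k D.mapAlgebra} (hmu : ∀ α, mu.eval α = ∑ i, (φ i).eval (D.ev (x i) α)) :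
    Φ.evClass = LieRepClass.ofDual mu :=
  (evClass_eq_of_cover hΦ hx hcover hφ).trans
    (LieRepClass.mk_eq_mk.2 (evRep_oneDim_iso hx φ mu hmu))

-- The empty family of points already covers the empty support.
theorem evClass_zero : (zero D).evClass = LieRepClass.trivial :=
  evClass_eq_ofDual zero_mem_irredFun (x := fun i : Fin 0 => i.elim0) (fun i => i.elim0)
    (fun _ h => absurd rfl h) (φ := fun i => i.elim0) (fun i => i.elim0) fun _ => rfl

/-- At representatives for both supports, `Φ` consists of characters $\varphi_i$ and its evaluation
class is the character $\sum_i\varphi_i\circ\mathrm{ev}_{x_i}$; twisting by it is twisting each slot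
by $\varphi_i$. -/
theorem evClass_tensor {Ψ Φ : D.ClassFun} (hΨ : Ψ ∈ D.irredFun) (hΦ : Φ ∈ D.irredFun)
    {mu : AbDual k D.mapAlgebra} (hmu : LieRepClass.ofDual mu = Φ.evClass) :
    (Ψ.tensor Φ).evClass = (LieRepClass.ofDual mu).tensor Ψ.evClass := by
  have hdim : Φ.evClass.dim = 1 := by rw [← hmu, LieRepClass.dim_ofDual]
  obtain ⟨n, x, hx, hcover⟩ :=
    D.exists_distinctOrbits_cover (Ψ.finite_support.union Φ.finite_support)
  obtain ⟨ρ, -, hρ', h⟩ := exists_evClass_eq hΨ hx fun y hy => hcover y (Or.inl hy)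
  choose φ hφ using fun i =>
    LieRepClass.exists_ofDual_eq (dim_eq_one_of_dim_evClass_eq_one hdim (x i))
  obtain ⟨nu, hnu⟩ := AbDual.exists_eval_eq
    (∑ i, (φ i).eval ∘ₗ (D.ev (x i) : D.mapAlgebra →ₗ[k] D.isotropy (x i))) fun α β => by
      rw [LinearMap.sum_apply]
      refine Finset.sum_eq_zero fun i _ => ?_
      exact (congrArg (φ i).eval (LieHom.map_lie (D.ev (x i)) α β)).trans (AbDual.eval_lie _ _ _)
  have hnu' : ∀ α, nu.eval α = ∑ i, (φ i).eval (D.ev (x i) α) := fun α => by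
    rw [hnu, LinearMap.sum_apply]
    rfl
  obtain rfl : mu = nu := LieRepClass.ofDual_injective <| hmu.trans <|
    evClass_eq_ofDual hΦ hx (fun y hy => hcover y (Or.inr hy)) hφ hnu'
  rw [h, LieRepClass.ofDual_tensor_mk, LieRepClass.mk_eq_mk.2 (twist_evRep_iso φ mu hnu')]
  refine evClass_eq_of_cover (tensor_mem_irredFun hΨ hdim) hx
    (fun y hy => hcover y (tensor_cover hy)) fun i => ?_
  rw [← LieRepClass.mk_tensor_ofDual, hρ', hφ]
  rfl

/-- `Φ` is the equivariant extension of the characters that compare the factors. The conclusion `Ψ'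
= Ψ.tensor Φ` is stronger than the equality of evaluation classes needed for the fibres. -/
theorem exists_ofDual_eq_evClass {lam lam' : AbDual k D.mapAlgebra} {Ψ Ψ' : D.ClassFun}
    (hΨ : Ψ ∈ D.irredFun) (hΨ' : Ψ' ∈ D.irredFun)
    (h : (LieRepClass.ofDual lam).tensor Ψ.evClass = (LieRepClass.ofDual lam').tensor Ψ'.evClass) :
    ∃ Φ ∈ D.irredFun, LieRepClass.ofDual (lam - lam' : AbDual k D.mapAlgebra) = Φ.evClass ∧
      Ψ' = Ψ.tensor Φ := by
  obtain ⟨n, x, hx, hcover⟩ :=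
    D.exists_distinctOrbits_cover (Ψ.finite_support.union Ψ'.finite_support)
  obtain ⟨ρ, hρ, hρΨ, h1⟩ := exists_evClass_eq hΨ hx fun y hy => hcover y (Or.inl hy)
  obtain ⟨ρ', hρ', hρΨ', h1'⟩ := exists_evClass_eq hΨ' hx fun y hy => hcover y (Or.inr hy)
  rw [h1, h1', LieRepClass.ofDual_tensor_mk, LieRepClass.ofDual_tensor_mk] at h
  obtain ⟨φ, hφ, hlam⟩ := exists_characters hx hρ hρ' (LieRepClass.mk_eq_mk.1 h)
  have hΦ : ofPoints hx (fun i => LieRepClass.ofDual (φ i)) ∈ D.irredFun :=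
    ofPoints_mem_irredFun hx _ fun i => LieRepClass.isIrreducible_ofDual _
  refine ⟨_, hΦ, (evClass_eq_ofDual hΦ hx (ofPoints_cover hx _)
    (fun i => (ofPoints_apply hx (fun i => LieRepClass.ofDual (φ i)) i).symm) hlam).symm, ?_⟩
  refine eq_of_cover (x := x) (fun y hy => hcover y (Or.inr hy)) (fun y hy => ?_) fun i => ?_
  · exact (tensor_cover hy).elim (fun h => hcover y (Or.inl h)) (ofPoints_cover hx _ y)
  · change _ = (Ψ.toFun (x i)).tensor _
    rw [ofPoints_apply, ← hρΨ, ← hρΨ', LieRepClass.mk_tensor_ofDual]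
    exact LieRepClass.mk_eq_mk.2 (hφ i).symm

theorem ofDual_tensor_evClass_injOn (lam : AbDual k D.mapAlgebra) {Ψ Ψ' : D.ClassFun}
    (hΨ : Ψ ∈ D.irredFun) (hΨ' : Ψ' ∈ D.irredFun)
    (h : (LieRepClass.ofDual lam).tensor Ψ.evClass = (LieRepClass.ofDual lam).tensor Ψ'.evClass) :
    Ψ = Ψ' := by
  obtain ⟨n, x, hx, hcover⟩ :=
    D.exists_distinctOrbits_cover (Ψ.finite_support.union Ψ'.finite_support)
  obtain ⟨ρ, hρ, hρΨ, h1⟩ := exists_evClass_eq hΨ hx fun y hy => hcover y (Or.inl hy)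
  obtain ⟨ρ', hρ', hρΨ', h1'⟩ := exists_evClass_eq hΨ' hx fun y hy => hcover y (Or.inr hy)
  rw [h1, h1', LieRepClass.ofDual_tensor_mk, LieRepClass.ofDual_tensor_mk] at h
  obtain ⟨φ, hφ, hlam⟩ := exists_characters hx hρ hρ' (LieRepClass.mk_eq_mk.1 h)
  obtain ⟨s, hs, hs'⟩ := exists_ev_section hx
  refine eq_of_cover (x := x) (fun y hy => hcover y (Or.inl hy))
    (fun y hy => hcover y (Or.inr hy)) fun i => ?_
  -- With equal characters the sum $\sum_j\varphi_j\circ\mathrm{ev}_{x_j}$ is zero, and evaluating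
  -- it on `s i u` leaves $\varphi_i(u)$.
  have h0 : φ i = 0 := AbDual.eval_injective <| LinearMap.ext fun u => by
    have h2 := hlam (s i u)
    rw [sub_self, Finset.sum_eq_single i (fun j _ hj => by rw [hs' i j hj.symm, map_zero])
      (by simp), hs] at h2
    exact h2.symm
  rw [← hρΨ, ← hρΨ', LieRepClass.mk_eq_mk]
  refine (LieFDRep.twist_zero_iso (ρ i)).symm.trans ?_
  rw [← h0]
  exact hφ i

end

end ClassFun

end EquivariantPair
-- The theorem
theorem mainTheorem1 {k : Type u} [Field k] [IsAlgClosed k] [CharZero k]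
    {A : Type v} [CommRing A] [Algebra k A]
    {𝔤 : Type w} [LieRing 𝔤] [LieAlgebra k 𝔤] [FiniteDimensional k 𝔤]
    {Γ : Type w'} [Group Γ] [Finite Γ] (D : EquivariantPair k A 𝔤 Γ) :
    -- `lam ⊗ ev_Ψ` is irreducible, so that the map `(lam, Ψ) ↦ lam ⊗ ev_Ψ` is well defined
    Set.MapsTo (fun p : AbDual k D.mapAlgebra × D.ClassFun =>
        (LieRepClass.ofDual p.1).tensor p.2.evClass)
      (Set.univ ×ˢ D.irredFun) D.irredClasses ∧
    -- it is surjective onto the classes of irreducible finite-dimensional representations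
    Set.SurjOn (fun p : AbDual k D.mapAlgebra × D.ClassFun =>
        (LieRepClass.ofDual p.1).tensor p.2.evClass)
      (Set.univ ×ˢ D.irredFun) D.irredClasses ∧
    -- every irreducible finite-dimensional representation is the tensor product of a
    -- one-dimensional representation and an evaluation representation
    (∀ ρ : LieFDRep.{u, max v w, w₁} k D.mapAlgebra, ρ.IsIrreducible →
      ∃ σ τ : LieFDRep.{u, max v w, u} k D.mapAlgebra,
        σ.dim = 1 ∧ D.IsEvaluation τ ∧ ρ.Iso (σ.tensor τ)) ∧
    -- `Ψ ⊗ Φ` belongs to `𝓔` when `ev_Φ` is one-dimensional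
    (∀ Ψ ∈ D.irredFun, ∀ Φ ∈ D.irredFun, Φ.evClass.dim = 1 → Ψ.tensor Φ ∈ D.irredFun) ∧
    -- description of the fibres
    (∀ lam lam' : AbDual k D.mapAlgebra, ∀ Ψ ∈ D.irredFun, ∀ Ψ' ∈ D.irredFun,
      (LieRepClass.ofDual lam).tensor Ψ.evClass = (LieRepClass.ofDual lam').tensor Ψ'.evClass ↔
        ∃ Φ ∈ D.irredFun, Φ.evClass.dim = 1 ∧
          (∃ mu : AbDual k D.mapAlgebra, LieRepClass.ofDual mu = Φ.evClass ∧ lam' = lam - mu) ∧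
          Ψ'.evClass = (Ψ.tensor Φ).evClass) ∧
    -- injectivity on each factor
    Function.Injective (fun lam : AbDual k D.mapAlgebra =>
      (LieRepClass.ofDual lam).tensor (EquivariantPair.ClassFun.zero D).evClass) ∧
    Set.InjOn (fun Ψ : D.ClassFun =>
      (LieRepClass.ofDual (0 : AbDual k D.mapAlgebra)).tensor Ψ.evClass) D.irredFun := by
  have hsurj : ∀ σ : LieFDRep.{u, max v w, u} k D.mapAlgebra, σ.IsIrreducible →
      ∃ lam : AbDual k D.mapAlgebra, ∃ Ψ ∈ D.irredFun,
        (LieRepClass.ofDual lam).tensor Ψ.evClass = LieRepClass.mk σ := fun σ hσ => by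
    obtain ⟨lam, n, x, ρ, hx, hρ, h⟩ := EquivariantPair.exists_twist_evRep_iso hσ
    have hΨ := EquivariantPair.ClassFun.ofPoints_mem_irredFun hx
      (fun i => LieRepClass.mk (ρ i)) hρ
    refine ⟨lam, _, hΨ, ?_⟩
    rw [EquivariantPair.ClassFun.evClass_eq_of_cover hΨ hx
      (EquivariantPair.ClassFun.ofPoints_cover hx _)
      fun i => (EquivariantPair.ClassFun.ofPoints_apply hx (fun i => LieRepClass.mk (ρ i)) i).symm,
      LieRepClass.ofDual_tensor_mk]
    exact LieRepClass.mk_eq_mk.2 h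
  refine ⟨fun p hp => EquivariantPair.ClassFun.isIrreducible_ofDual_tensor_evClass p.1 hp.2,
    fun c hc => ?_, fun ρ hρ => ?_, fun Ψ hΨ Φ _ hdim =>
      EquivariantPair.ClassFun.tensor_mem_irredFun hΨ hdim,
    fun lam lam' Ψ hΨ Ψ' hΨ' => ⟨fun h => ?_, ?_⟩, fun lam lam' h => ?_,
    fun Ψ hΨ Ψ' hΨ' h => EquivariantPair.ClassFun.ofDual_tensor_evClass_injOn 0 hΨ hΨ' h⟩
  · obtain ⟨σ, rfl⟩ := LieRepClass.exists_eq_mk c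
    obtain ⟨lam, Ψ, hΨ, h⟩ := hsurj σ hc
    exact ⟨(lam, Ψ), ⟨Set.mem_univ _, hΨ⟩, h⟩
  -- The given representation may live in any universe, whereas the classification is for spaces in
  -- the universe of `k`.
  · obtain ⟨σ, hσ⟩ := ρ.exists_iso_small
    obtain ⟨lam, n, x, τ, hx, -, h⟩ :=
      EquivariantPair.exists_twist_evRep_iso (hσ.isIrreducible hρ)
    exact ⟨LieFDRep.oneDim lam, D.evRep x τ, LieFDRep.dim_oneDim lam,
      ⟨n, x, τ, fun i j hij => hx i j ⟨1, (D.actPoint_one _).trans hij⟩, LieFDRep.Iso.refl _⟩,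
      hσ.trans (h.symm.trans (LieFDRep.oneDim_tensor_iso lam _).symm)⟩
  · obtain ⟨Φ, hΦ, hmu, rfl⟩ := EquivariantPair.ClassFun.exists_ofDual_eq_evClass hΨ hΨ' h
    exact ⟨Φ, hΦ, by rw [← hmu, LieRepClass.dim_ofDual],
      ⟨lam - lam', hmu, (sub_sub_cancel lam lam').symm⟩, rfl⟩
  · rintro ⟨Φ, hΦ, -, ⟨mu, hmu, rfl⟩, h⟩
    rw [h, EquivariantPair.ClassFun.evClass_tensor hΨ hΦ hmu,
      LieRepClass.ofDual_tensor_ofDual_tensor, sub_add_cancel]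
  · refine LieRepClass.ofDual_injective ?_
    simpa only [EquivariantPair.ClassFun.evClass_zero, LieRepClass.tensor_trivial] using h

end
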